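/- **Setting.** Let $n\ge 1$, $L_0>0$, and let $X\subseteq\mathbb R^n$ be a nonempty bounded convex set (closed, so that the Euclidean projection $\Pi_X$ is defined) with diameter $D_X=\sup_{x,x'\in X}\|x-x'\|$. Consider $\min_{x\in X} f(x)$ for a function $f:\mathbb R^n\to\mathbb R$, with a minimizer $x^*\in X$ of $f$ over $X$ and $f^*=f(x^*)$. Let $G(\cdot,s)$, $s\sim\nu$, be a random function (jointly measurable) with $f(x)=\mathbb E_{s\sim\nu}[G(x,s)]$ (finite for every $x$), arising in one of the following three ways: 1. (*standard*) $G(x,s)=F(x,s)$, where $F(\cdot,s)$ is convex on $\mathbb R^n$ for almost every $s$ and the law $\nu$ does not depend on $x$; 2. (*decision-dependent, known density*) $f(x)=\int \hat F(x,\xi)\,p(\xi\mid x)\,d\xi$ is convex on $\mathbb R^n$, where each $p(\cdot\mid x)$ is a probability density, $\tilde p$ is a probability density that is positive wherever some $p(\cdot\mid x)$ is, $\nu$ has density $\tilde p$, and $G(x,\xi)=\hat F(x,\xi)\,p(\xi\mid x)/\tilde p(\xi)$; 3. (*decision-dependent, unknown distribution*) $f(x)=\mathbb E_{\xi\sim\mathcal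 D(x)}[\hat F(x,\xi)]$ is convex on $\mathbb R^n$, $(\boldsymbol\xi_x)_{x\in\mathbb R^n}$ is a measurable $\mathbb R^d$-valued random field with marginals $\boldsymbol\xi_x\sim\mathcal D(x)$, $s\sim\nu$ is the randomness that generates the field, and $G(x,s)=\hat F(x,\boldsymbol\xi_x(s))$. Assume the sub-Gaussian property $$\mathbb E_{s\sim\nu}\left[\exp\left(|G(x,s)-G(y,s)|^2\right)\right]\le \exp\left(L_0^2\|x-y\|^2\right)\qquad\text{for all }x,y\in\mathbb R^n .$$ For $\eta>0$ define the exponentially-shifted Gaussian smoothing estimator $\tilde g_\eta(x,v,z,s)\in\mathbb R^n$ by $$\tilde g^i_\eta(x,v,z,s)=\frac{1}{\eta\sqrt{2\pi}}\Big[G\big((x_i+\eta\sqrt{2v},\,x^{-i}-z^{-i}),s\big)-G\big((x_i-\eta\sqrt{2v},\,x^{-i}-z^{-i}),s\big)\Big],\qquad 1\le i\le n,$$ where $(x_i+t,\,x^{-i}-z^{-i})$ is the point with $i$-th coordinate $x_i+t$ and $j$-th coordinate $x_j-z_j$ for $j\ne i$. Let $\gamma_k=\eta_k=(k+1)^{-1/2}$,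 let $x_0\in X$, and for $k\ge 0$ let $$x_{k+1}=\Pi_X\big[x_k-\gamma_k\,\tilde g_{\eta_k}(x_k,V_k,Z_k,s_k)\big],$$ where $V_k\sim\mathrm{Exp}(1)$, $Z_k\sim\mathcal N_n(0,\eta_k^2 I)$, $s_k\sim\nu$, and $x_0$ (possibly random) and all the $V_k,Z_k,s_k$, $k\ge0$, are mutually independent. Let $\bar x_K=\big(\sum_{k=0}^{K-1}\gamma_kx_k\big)/\sum_{k=0}^{K-1}\gamma_k$. **Corollary 4.8 (a.s. rate).** Almost surely, $f(\bar x_K)-f^*=\mathcal O\!\left(\frac{n\ln K}{\sqrt K}\right)$ as $K\to\infty$, with a constant independent of $n$ and $K$. Precisely: there is a constant $C>0$ depending only on $L_0$ and $D_X$ such that, for all $n$ and all data as above, almost surely $$0\le f(\bar x_K)-f^*\le \frac{C\,n\ln K}{\sqrt K}\qquad\text{for all but finitely many }K .$$ -/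

import Mathlib

open MeasureTheory ProbabilityTheory Filter

noncomputable section

/-- The decision space `ℝⁿ` with its Euclidean norm. -/
abbrev Vec (n : ℕ) : Type := EuclideanSpace ℝ (Fin n)

/-- The law `𝒩ₙ(0, η² I)` of `η` times a standard Gaussian vector. -/
def gaussianVec (n : ℕ) (η : ℝ) : Measure (Vec n) :=
  (stdGaussian (Vec n)).map (fun z => η • z)

/-- The point `(xᵢ + t, x⁻ⁱ - z⁻ⁱ)`: coordinate `i` is shifted by `t`, every other coordinate `j`
is shifted by `-zⱼ`. -/
def shiftedPoint {n : ℕ} (i : Fin n) (t : ℝ) (x z : Vec n) : Vec n :=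
  WithLp.toLp 2 (fun j => if j = i then x j + t else x j - z j)

/-- The exponentially-shifted Gaussian smoothing (esGs) gradient estimator built from the values of
a function `h`. Its `i`-th component is
`(h (xᵢ + η√(2v), x⁻ⁱ - z⁻ⁱ) - h (xᵢ - η√(2v), x⁻ⁱ - z⁻ⁱ)) / (η√(2π))`. -/
def esGs {n : ℕ} (η : ℝ) (h : Vec n → ℝ) (x : Vec n) (v : ℝ) (z : Vec n) : Vec n :=
  WithLp.toLp 2 (fun i =>
    (1 / (η * √(2 * Real.pi))) *
      (h (shiftedPoint i (η * √(2 * v)) x z) - h (shiftedPoint i (-(η * √(2 * v))) x z)))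

/-- `y` is the Euclidean projection `Π_X[u]` of `u` onto `X`. -/
def IsEuclideanProjection {n : ℕ} (X : Set (Vec n)) (u y : Vec n) : Prop :=
  y ∈ X ∧ ∀ z ∈ X, ‖u - y‖ ≤ ‖u - z‖

section Models

variable {n : ℕ} {S : Type*} [MeasurableSpace S]

/-- The standard setting: `f x = 𝔼[F(x, ξ)]` with `ξ ∼ ν`, where `ν` does not depend on `x` and
`F(·, ξ)` is convex on `ℝⁿ` for almost every `ξ`. -/
structure StandardModel (ν : Measure S) (F : Vec n → S → ℝ) (f : Vec n → ℝ) : Prop where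
  measurable : Measurable (Function.uncurry F)
  integrable : ∀ x, Integrable (F x) ν
  objective : ∀ x, f x = ∫ s, F x s ∂ν
  convex : ∀ᵐ s ∂ν, ConvexOn ℝ Set.univ (fun x => F x s)

/-- The decision-dependent setting with known densities `p(· | x)` (with respect to a reference
measure `lam`, e.g. Lebesgue measure; `p(· | x)` is zero outside the support `Ξ(x)`):
`f x = ∫ F̂(x, ξ) p(ξ | x) dξ` is convex on `ℝⁿ`, `ptil` is a probability density that is positive
wherever one of the `p(· | x)` is, `ν` is the law with density `ptil`, and
`G x ξ = F̂(x, ξ) p(ξ | x) / ptil(ξ)` is the reweighted integrand. -/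
structure KnownDensityModel (lam : Measure S) (ptil : S → ℝ) (p Fhat : Vec n → S → ℝ)
    (ν : Measure S) (G : Vec n → S → ℝ) (f : Vec n → ℝ) : Prop where
  measurable_p : Measurable (Function.uncurry p)
  p_nonneg : ∀ x s, 0 ≤ p x s
  p_density : ∀ x, ∫⁻ s, ENNReal.ofReal (p x s) ∂lam = 1
  measurable_ptil : Measurable ptil
  ptil_nonneg : ∀ s, 0 ≤ ptil s
  ptil_density : ∫⁻ s, ENNReal.ofReal (ptil s) ∂lam = 1
  ptil_pos : ∀ x s, 0 < p x s → 0 < ptil s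
  measurable_Fhat : Measurable (Function.uncurry Fhat)
  integrable : ∀ x, Integrable (fun s => Fhat x s * p x s) lam
  objective : ∀ x, f x = ∫ s, Fhat x s * p x s ∂lam
  convex : ConvexOn ℝ Set.univ f
  sampling : ν = lam.withDensity (fun s => ENNReal.ofReal (ptil s))
  integrand : ∀ x s, G x s = Fhat x s * (p x s / ptil s)

/-- The decision-dependent setting with unknown distributions `𝒟(x)`: `ξ` is a (jointly measurable)
random field `(ξ_x)_{x ∈ ℝⁿ}` with values in `ℝᵈ`, realised on the probability space `(S, ν)`, whose
marginals are `ξ_x ∼ 𝒟(x)`, and `f x = 𝔼_{ξ ∼ 𝒟(x)}[F̂(x, ξ)]` is convex on `ℝⁿ`. A point `s : S`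
stands for one realisation of the whole field, and `G x s = F̂(x, ξ_x(s))`. -/
structure RandomFieldModel {d : ℕ} (ξ : Vec n → S → Vec d) (𝒟 : Vec n → Measure (Vec d))
    (Fhat : Vec n → Vec d → ℝ)
    (ν : Measure S) (G : Vec n → S → ℝ) (f : Vec n → ℝ) : Prop where
  measurable_field : Measurable (Function.uncurry ξ)
  marginal : ∀ x, ν.map (ξ x) = 𝒟 x
  measurable_Fhat : Measurable (Function.uncurry Fhat)
  integrable : ∀ x, Integrable (Fhat x) (𝒟 x)
  objective : ∀ x, f x = ∫ w, Fhat x w ∂(𝒟 x)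
  convex : ConvexOn ℝ Set.univ f
  integrand : ∀ x s, G x s = Fhat x (ξ x s)

/-- The objective `f` and the random integrand `G(·, s)`, `s ∼ ν`, that the gradient estimator
evaluates come from one of the three settings: standard, decision-dependent with known densities,
or decision-dependent with unknown distributions. -/
def IsProblemModel (ν : Measure S) (G : Vec n → S → ℝ) (f : Vec n → ℝ) : Prop :=
  StandardModel ν G f ∨
  (∃ (lam : Measure S) (ptil : S → ℝ) (p Fhat : Vec n → S → ℝ),
    KnownDensityModel lam ptil p Fhat ν G f) ∨
  (∃ (d : ℕ) (ξ : Vec n → S → Vec d) (𝒟 : Vec n → Measure (Vec d)) (Fhat : Vec n → Vec d → ℝ),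
    RandomFieldModel ξ 𝒟 Fhat ν G f)

/-- The sub-Gaussian property
`𝔼[exp(|G(x, s) - G(y, s)|²)] ≤ exp(L₀² ‖x - y‖²)` for all `x, y ∈ ℝⁿ`. The expectation is a Lebesgue
integral in `[0, ∞]`, so that its finiteness is part of the property. -/
def SubGaussianIncrements (ν : Measure S) (G : Vec n → S → ℝ) (L₀ : ℝ) : Prop :=
  ∀ x y : Vec n, ∫⁻ s, ENNReal.ofReal (Real.exp (|G x s - G y s| ^ 2)) ∂ν
    ≤ ENNReal.ofReal (Real.exp (L₀ ^ 2 * ‖x - y‖ ^ 2))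

/-- The process `x` is generated by the projected zeroth-order stochastic gradient method
`x_{k+1} = Π_X[x_k - γ_k g̃_{η_k}(x_k, V_k, Z_k, ξ_k)]` on the probability space `(Ω, P)`.
For every `k`, `V_k ∼ Exp(1)`, `Z_k ∼ 𝒩ₙ(0, η_k² I)` and `ξ_k ∼ ν` are independent (field `law`), and
the triple `(V_k, Z_k, ξ_k)` is independent of the past `x_0, (V_j, Z_j, ξ_j)_{j < k}`
(field `indep`). -/
structure IsZerothOrderSGD {Ω : Type*} [MeasurableSpace Ω] (P : Measure Ω)
    (ν : Measure S) (G : Vec n → S → ℝ) (X : Set (Vec n)) (γ η : ℕ → ℝ)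
    (V : ℕ → Ω → ℝ) (Z : ℕ → Ω → Vec n) (ξ : ℕ → Ω → S) (x : ℕ → Ω → Vec n) : Prop where
  measurable_V : ∀ k, Measurable (V k)
  measurable_Z : ∀ k, Measurable (Z k)
  measurable_ξ : ∀ k, Measurable (ξ k)
  measurable_init : Measurable (x 0)
  init_mem : ∀ ω, x 0 ω ∈ X
  law : ∀ k, P.map (fun ω => (V k ω, Z k ω, ξ k ω))
    = (expMeasure 1).prod ((gaussianVec n (η k)).prod ν)
  indep : ∀ k, IndepFun (fun ω => (V k ω, Z k ω, ξ k ω))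
    (fun ω => (x 0 ω, fun j : Fin k => (V j ω, Z j ω, ξ j ω))) P
  step : ∀ k ω, IsEuclideanProjection X
    (x k ω - γ k • esGs (η k) (fun y => G y (ξ k ω)) (x k ω) (V k ω) (Z k ω)) (x (k + 1) ω)

end Models

/-- The weighted average `x̄_K = (∑_{k<K} γ_k x_k) / (∑_{k<K} γ_k)`. -/
def weightedAverage {n : ℕ} (γ : ℕ → ℝ) (x : ℕ → Vec n) (K : ℕ) : Vec n :=
  (∑ k ∈ Finset.range K, γ k)⁻¹ • ∑ k ∈ Finset.range K, γ k • x k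

/-- The sequence `1 / (k + 1)^{1/2}`. -/
def invSqrtStep (k : ℕ) : ℝ := 1 / √((k : ℝ) + 1)

end

/-! Along one projected step, `‖x - a‖²` with `a = xstar` grows by at most `U = γ²‖g‖² - 2γ⟪g, x -
a⟫`, where `g` is the estimator (`stepIncrement`). A Stein identity at the scale `√(2V)`, `V ∼
Exp(1)`, shows that `g` is unbiased for the gradient of the Gaussian smoothing `f_η`
(`hasDerivAt_gaussianSmoothing`, `integral_esGs_coord`). As `f_η` is convex and lies between `f` and
`f + L₀ η (1 + n) / 2`, and `𝔼‖g‖² ≤ 2 n L₀²` uniformly in `η`, the conditional mean of `U` is at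
most `-2γ (f x - f a)` plus a term of size `n γ²` when `γ = η` (`integral_stepIncrement_le`). These
terms add up to `O(n H_K)`, with `H_K = ∑_{k<K} 1/(k+1)`.

The centred increments are martingale differences. The sub-Gaussian property also bounds fourth
moments, `𝔼‖g‖⁴ = O(η⁻²)`, so with `γ = η` their variances are `O(γ²) = O(1/(k+1))`
(`lintegral_stepIncrement_sq_le`). A strong law (`ae_tendsto_sum_div_of_condExp_eq_zero`: bounded
martingale plus Kronecker) makes their sum `o(1 + H_K)` almost surely. The variance bound may thus
depend on `n` and on the diameter: eventually the noise is at most `1 + H_K`, and so is the squared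
diameter. Hence `∑ γ_k (f x_k - f a) ≤ C n log K`, and Jensen together with `∑ γ_k ≥ √K` gives the
rate. -/

/-! ### Moments of variables with a squared-exponential moment -/

/-- After multiplication by `exp s` the claim is that `2 + 2s + (s² - 2) exp s` is nonnegative. It
vanishes at `0`, and its derivative `2 (1 - (1 - s) exp s) + s² exp s` is nonnegative for `s ≥ 0`.
-/
theorem exp_neg_quadratic_lower {s : ℝ} (hs : 0 ≤ s) :
    s ^ 2 ≤ 2 * (1 + s) * (Real.exp (-s) - 1 + s) := by
  have hderiv : ∀ x : ℝ, HasDerivAt (fun x : ℝ => 2 + 2 * x + (x ^ 2 - 2) * Real.exp x)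
      (2 + (x ^ 2 + 2 * x - 2) * Real.exp x) x := by
    intro x
    have h := (((hasDerivAt_id x).const_mul 2).const_add 2).add
      ((((hasDerivAt_id x).pow 2).sub_const 2).mul (Real.hasDerivAt_exp x))
    refine (h.congr_deriv ?_)
    simp
    ring
  have hmono : MonotoneOn (fun x : ℝ => 2 + 2 * x + (x ^ 2 - 2) * Real.exp x) (Set.Ici 0) := by
    refine monotoneOn_of_deriv_nonneg (convex_Ici 0)
      (fun x _ => (hderiv x).continuousAt.continuousWithinAt)
      (fun x _ => (hderiv x).differentiableAt.differentiableWithinAt) ?_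
    intro x hx
    rw [interior_Ici] at hx
    have hx0 : 0 < x := hx
    rw [(hderiv x).deriv]
    have h1 : (1 - x) * Real.exp x ≤ 1 := by
      have := Real.add_one_le_exp (-x)
      have h2 : (1 - x) * Real.exp x ≤ Real.exp (-x) * Real.exp x := by
        gcongr; linarith
      rwa [← Real.exp_add, neg_add_cancel, Real.exp_zero] at h2
    nlinarith [Real.exp_pos x, mul_pos (sq_pos_of_pos hx0) (Real.exp_pos x)]
  have h0 := hmono (Set.mem_Ici.2 le_rfl) (Set.mem_Ici.2 hs) hs
  simp only [Real.exp_zero] at h0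
  have hE : Real.exp (-s) * Real.exp s = 1 := by
    rw [← Real.exp_add, neg_add_cancel, Real.exp_zero]
  have h1 := mul_le_mul_of_nonneg_left h0 (Real.exp_pos (-s)).le
  have h2 : Real.exp (-s) * (2 + 2 * s + (s ^ 2 - 2) * Real.exp s)
      = Real.exp (-s) * (2 + 2 * s) + (s ^ 2 - 2) * (Real.exp (-s) * Real.exp s) := by ring
  rw [h2, hE] at h1
  nlinarith

/-- The tangent line of the concave function `y ↦ (1 + log y)²` on `[1, ∞)`, in the variables
`u = log y` and `b = log a`. -/
theorem one_add_sq_le_exp_tangent {u b : ℝ} (hu : 0 ≤ u) (hb : 0 ≤ b) :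
    (1 + u) ^ 2 ≤ (1 + b) ^ 2 + 2 * (1 + b) * (Real.exp (u - b) - 1) := by
  rcases le_total b u with h | h
  · have := Real.quadratic_le_exp_of_nonneg (sub_nonneg.2 h)
    nlinarith [sq_nonneg (u - b)]
  · have h1 := exp_neg_quadratic_lower (sub_nonneg.2 h)
    rw [neg_sub] at h1
    have h2 : (1 + (b - u)) * (Real.exp (u - b) - 1 + (b - u))
        ≤ (1 + b) * (Real.exp (u - b) - 1 + (b - u)) := by
      have := Real.add_one_le_exp (u - b)
      gcongr <;> linarith
    nlinarith

section Moments

variable {S : Type*} [MeasurableSpace S] {ν : Measure S} {Δ : S → ℝ} {b : ℝ}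

theorem integrable_exp_sq_of_lintegral_le (hΔ : Measurable Δ)
    (h : ∫⁻ s, ENNReal.ofReal (Real.exp (|Δ s| ^ 2)) ∂ν ≤ ENNReal.ofReal (Real.exp b)) :
    Integrable (fun s => Real.exp (Δ s ^ 2)) ν ∧ ∫ s, Real.exp (Δ s ^ 2) ∂ν ≤ Real.exp b := by
  simp only [sq_abs] at h
  have hm : AEStronglyMeasurable (fun s => Real.exp (Δ s ^ 2)) ν :=
    (Real.measurable_exp.comp (hΔ.pow_const 2)).aestronglyMeasurable
  refine ⟨⟨hm, ?_⟩, ?_⟩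
  · rw [hasFiniteIntegral_iff_ofReal (ae_of_all _ fun s => (Real.exp_pos _).le)]
    exact h.trans_lt ENNReal.ofReal_lt_top
  · rw [integral_eq_lintegral_of_nonneg_ae (ae_of_all _ fun s => (Real.exp_pos _).le) hm]
    exact ENNReal.toReal_le_of_le_ofReal (Real.exp_pos _).le h

theorem integrable_sq_of_lintegral_le {c : ℝ} (hΔ : Measurable Δ)
    (h : ∫⁻ s, ENNReal.ofReal (Δ s ^ 2) ∂ν ≤ ENNReal.ofReal c) :
    Integrable (fun s => Δ s ^ 2) ν :=
  ⟨(hΔ.pow_const 2).aestronglyMeasurable, by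
    rw [hasFiniteIntegral_iff_ofReal (ae_of_all _ fun s => sq_nonneg _)]
    exact h.trans_lt ENNReal.ofReal_lt_top⟩

theorem integral_le_of_lintegral_ofReal_le {φ : S → ℝ} {c : ℝ} (hφ : Measurable φ)
    (hφ0 : ∀ s, 0 ≤ φ s) (hc : 0 ≤ c)
    (h : ∫⁻ s, ENNReal.ofReal (φ s) ∂ν ≤ ENNReal.ofReal c) : ∫ s, φ s ∂ν ≤ c := by
  rw [integral_eq_lintegral_of_nonneg_ae (ae_of_all _ hφ0) hφ.aestronglyMeasurable]
  exact ENNReal.toReal_le_of_le_ofReal hc h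

variable [IsProbabilityMeasure ν]

/-- Since `𝔼 exp(Δ² - b) ≤ 1`, the correction with coefficient `d ≥ 0` has nonpositive mean. This is
Jensen for concave functions of `exp(Δ²)`, used through their tangent lines at `exp b`. -/
theorem lintegral_le_of_le_exp_affine {φ : S → ℝ} {c d : ℝ} (hΔ : Measurable Δ)
    (h : ∫⁻ s, ENNReal.ofReal (Real.exp (|Δ s| ^ 2)) ∂ν ≤ ENNReal.ofReal (Real.exp b))
    (hd : 0 ≤ d) (hφ0 : ∀ s, 0 ≤ φ s)
    (hφ : ∀ s, φ s ≤ c + d * (Real.exp (Δ s ^ 2 - b) - 1)) :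
    ∫⁻ s, ENNReal.ofReal (φ s) ∂ν ≤ ENNReal.ofReal c := by
  obtain ⟨hi, hle⟩ := integrable_exp_sq_of_lintegral_le hΔ h
  have hi₁ : Integrable (fun s => d * (Real.exp (Δ s ^ 2 - b) - 1)) ν := by
    simp only [Real.exp_sub]
    exact ((hi.div_const _).sub (integrable_const _)).const_mul _
  have hi' : Integrable (fun s => c + d * (Real.exp (Δ s ^ 2 - b) - 1)) ν :=
    (integrable_const c).add hi₁
  calc ∫⁻ s, ENNReal.ofReal (φ s) ∂ν
      ≤ ∫⁻ s, ENNReal.ofReal (c + d * (Real.exp (Δ s ^ 2 - b) - 1)) ∂ν :=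
        lintegral_mono fun s => ENNReal.ofReal_le_ofReal (hφ s)
    _ = ENNReal.ofReal (∫ s, (c + d * (Real.exp (Δ s ^ 2 - b) - 1)) ∂ν) :=
        (ofReal_integral_eq_lintegral_ofReal hi'
          (ae_of_all _ fun s => (hφ0 s).trans (hφ s))).symm
    _ ≤ ENNReal.ofReal c := by
        refine ENNReal.ofReal_le_ofReal ?_
        rw [integral_add (integrable_const c) hi₁]
        simp only [Real.exp_sub]
        rw [integral_const_mul, integral_sub (hi.div_const _) (integrable_const _),
          integral_div]
        have : (∫ s, Real.exp (Δ s ^ 2) ∂ν) / Real.exp b ≤ 1 :=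
          (div_le_one (Real.exp_pos _)).2 hle
        simp only [integral_const, probReal_univ, smul_eq_mul, one_mul]
        nlinarith

theorem lintegral_sq_le_of_exp_sq (hΔ : Measurable Δ)
    (h : ∫⁻ s, ENNReal.ofReal (Real.exp (|Δ s| ^ 2)) ∂ν ≤ ENNReal.ofReal (Real.exp b)) :
    ∫⁻ s, ENNReal.ofReal (Δ s ^ 2) ∂ν ≤ ENNReal.ofReal b := by
  refine lintegral_le_of_le_exp_affine (d := 1) hΔ h zero_le_one (fun s => sq_nonneg _)
    (fun s => ?_)
  have := Real.add_one_le_exp (Δ s ^ 2 - b)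
  linarith

/-- The function `(log y)²` is not concave near `y = 1`, whereas `(1 + log y)²` is concave on `[1,
∞)`. The price is the term `2 * b`, which dominates for nearby points. -/
theorem lintegral_fourth_le_of_exp_sq (hΔ : Measurable Δ) (hb : 0 ≤ b)
    (h : ∫⁻ s, ENNReal.ofReal (Real.exp (|Δ s| ^ 2)) ∂ν ≤ ENNReal.ofReal (Real.exp b)) :
    ∫⁻ s, ENNReal.ofReal (Δ s ^ 4) ∂ν ≤ ENNReal.ofReal (2 * b + b ^ 2) := by
  refine lintegral_le_of_le_exp_affine (c := 2 * b + b ^ 2) (d := 2 * (1 + b)) hΔ h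
    (by positivity) (fun s => by positivity) (fun s => ?_)
  have := one_add_sq_le_exp_tangent (sq_nonneg (Δ s)) hb
  nlinarith [sq_nonneg (Δ s)]

theorem integrable_of_integrable_sq (hΔ : Measurable Δ) (h : Integrable (fun s => Δ s ^ 2) ν) :
    Integrable Δ ν := by
  refine ((integrable_const (1 : ℝ)).add h).mono' hΔ.aestronglyMeasurable (ae_of_all _ fun s => ?_)
  rw [Real.norm_eq_abs, Pi.add_apply]
  nlinarith [sq_nonneg (|Δ s| - 1), sq_abs (Δ s)]

theorem abs_integral_le_of_integral_sq_le {r : ℝ} (hr : 0 < r) (hΔ : Measurable Δ)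
    (hi : Integrable (fun s => Δ s ^ 2) ν) (h : ∫ s, Δ s ^ 2 ∂ν ≤ r ^ 2) :
    |∫ s, Δ s ∂ν| ≤ r := by
  -- Cauchy–Schwarz in the form `|Δ| ≤ Δ²/(2r) + r/2`, which needs `r > 0`.
  have h1 : ∫ s, |Δ s| ∂ν ≤ ∫ s, (Δ s ^ 2 / (2 * r) + r / 2) ∂ν := by
    refine integral_mono (integrable_of_integrable_sq hΔ hi).abs
      ((hi.div_const _).add (integrable_const _)) fun s => ?_
    have : Δ s ^ 2 / (2 * r) + r / 2 - |Δ s| = (|Δ s| - r) ^ 2 / (2 * r) := by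
      field_simp
      rw [← sq_abs (Δ s)]
      ring
    have h2 : 0 ≤ (|Δ s| - r) ^ 2 / (2 * r) := by positivity
    linarith
  rw [integral_add (hi.div_const _) (integrable_const _), integral_div] at h1
  simp only [integral_const, probReal_univ, smul_eq_mul, one_mul] at h1
  have h3 : (∫ s, Δ s ^ 2 ∂ν) / (2 * r) ≤ r / 2 := by
    rw [div_le_div_iff₀ (by positivity) two_pos]
    nlinarith
  exact (abs_integral_le_integral_abs).trans (by linarith)

end Moments

/-! ### What the three problem settings have in common -/

/-- `f` is convex and is the mean of the jointly measurable random integrand `G`. -/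
structure ConvexStochasticModel {n : ℕ} {S : Type*} [MeasurableSpace S] (ν : Measure S)
    (G : Vec n → S → ℝ) (f : Vec n → ℝ) : Prop where
  measurable : Measurable (Function.uncurry G)
  integrable : ∀ x, Integrable (G x) ν
  objective : ∀ x, f x = ∫ s, G x s ∂ν
  convex : ConvexOn ℝ Set.univ f

section Models

variable {n : ℕ} {S : Type*} [MeasurableSpace S] {ν : Measure S} {G : Vec n → S → ℝ}
  {f : Vec n → ℝ}

theorem StandardModel.convexStochasticModel (h : StandardModel ν G f) :
    ConvexStochasticModel ν G f where
  measurable := h.measurable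
  integrable := h.integrable
  objective := h.objective
  convex := by
    refine ⟨convex_univ, fun x _ y _ a b ha hb hab => ?_⟩
    simp only [h.objective, smul_eq_mul, ← integral_const_mul]
    rw [← integral_add ((h.integrable x).const_mul a) ((h.integrable y).const_mul b)]
    refine integral_mono_ae (h.integrable _)
      (((h.integrable x).const_mul a).add ((h.integrable y).const_mul b)) ?_
    filter_upwards [h.convex] with s hs
    exact hs.2 (Set.mem_univ x) (Set.mem_univ y) ha hb hab

theorem KnownDensityModel.convexStochasticModel {lam : Measure S} {ptil : S → ℝ}
    {p Fhat : Vec n → S → ℝ} (h : KnownDensityModel lam ptil p Fhat ν G f) :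
    ConvexStochasticModel ν G f := by
  have hG : G = fun x s => Fhat x s * (p x s / ptil s) := by
    funext x s
    exact h.integrand x s
  have hmul : ∀ x s, (ENNReal.ofReal (ptil s)).toReal • G x s = Fhat x s * p x s := by
    intro x s
    rw [ENNReal.toReal_ofReal (h.ptil_nonneg s), h.integrand, smul_eq_mul]
    -- Where `p x s = 0` both sides vanish, whatever `ptil s` is; elsewhere `ptil s` is positive and
    -- cancels.
    rcases (h.p_nonneg x s).eq_or_lt with h0 | h0
    · simp [← h0]
    · have := (h.ptil_pos x s h0).ne'
      field_simp
  have hmeas : Measurable fun s => ENNReal.ofReal (ptil s) := h.measurable_ptil.ennreal_ofReal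
  refine ⟨?_, fun x => ?_, fun x => ?_, h.convex⟩
  · rw [hG]
    exact h.measurable_Fhat.mul (h.measurable_p.div (h.measurable_ptil.comp measurable_snd))
  · rw [h.sampling, integrable_withDensity_iff_integrable_smul' hmeas
      (ae_of_all _ fun _ => ENNReal.ofReal_lt_top)]
    simp only [hmul]
    exact h.integrable x
  · rw [h.sampling, integral_withDensity_eq_integral_toReal_smul hmeas
      (ae_of_all _ fun _ => ENNReal.ofReal_lt_top), h.objective]
    simp only [hmul]

theorem RandomFieldModel.convexStochasticModel {d : ℕ} {ξ : Vec n → S → Vec d}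
    {𝒟 : Vec n → Measure (Vec d)} {Fhat : Vec n → Vec d → ℝ}
    (h : RandomFieldModel ξ 𝒟 Fhat ν G f) : ConvexStochasticModel ν G f := by
  have hG : G = fun x s => Fhat x (ξ x s) := by
    funext x s
    exact h.integrand x s
  have hξ : ∀ x, Measurable (ξ x) := fun x => h.measurable_field.comp measurable_prodMk_left
  have hF : ∀ x, Measurable (Fhat x) := fun x => h.measurable_Fhat.comp measurable_prodMk_left
  refine ⟨?_, fun x => ?_, fun x => ?_, h.convex⟩
  · rw [hG]
    exact h.measurable_Fhat.comp (measurable_fst.prodMk h.measurable_field)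
  · rw [hG]
    have := h.integrable x
    rw [← h.marginal x] at this
    exact this.comp_measurable (hξ x)
  · rw [hG, h.objective, ← h.marginal x]
    exact integral_map (hξ x).aemeasurable (hF x).aestronglyMeasurable

theorem IsProblemModel.convexStochasticModel (h : IsProblemModel ν G f) :
    ConvexStochasticModel ν G f := by
  rcases h with h | ⟨_, _, _, _, h⟩ | ⟨_, _, _, _, h⟩
  exacts [h.convexStochasticModel, h.convexStochasticModel, h.convexStochasticModel]

theorem ConvexStochasticModel.measurable_section (h : ConvexStochasticModel ν G f) (x : Vec n) :
    Measurable (G x) := h.measurable.comp measurable_prodMk_left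

variable [IsProbabilityMeasure ν] {L₀ : ℝ}

theorem ConvexStochasticModel.abs_sub_le (h : ConvexStochasticModel ν G f)
    (hG : SubGaussianIncrements ν G L₀) (hL : 0 < L₀) (x y : Vec n) :
    |f x - f y| ≤ L₀ * ‖x - y‖ := by
  rcases eq_or_ne x y with rfl | hxy
  · simp
  have hm : Measurable fun s => G x s - G y s :=
    (h.measurable_section x).sub (h.measurable_section y)
  have h2 := lintegral_sq_le_of_exp_sq hm (hG x y)
  rw [h.objective, h.objective, ← integral_sub (h.integrable x) (h.integrable y)]
  refine abs_integral_le_of_integral_sq_le (mul_pos hL (norm_pos_iff.2 (sub_ne_zero.2 hxy))) hm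
    (integrable_sq_of_lintegral_le hm h2) ?_
  rw [mul_pow]
  exact integral_le_of_lintegral_ofReal_le (hm.pow_const 2) (fun s => sq_nonneg _)
    (by positivity) h2

end Models

/-! ### The one-dimensional smoothing identity -/

theorem integral_expMeasure_one (g : ℝ → ℝ) :
    ∫ v, g v ∂(expMeasure 1) = ∫ v in Set.Ioi 0, Real.exp (-v) * g v := by
  have hm : Measurable (gammaPDF 1 1) := (measurable_gammaPDFReal 1 1).ennreal_ofReal
  rw [expMeasure, gammaMeasure, integral_withDensity_eq_integral_toReal_smul hm
    (ae_of_all _ fun _ => ENNReal.ofReal_lt_top), ← integral_Ici_eq_integral_Ioi,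
    ← integral_indicator measurableSet_Ici]
  refine integral_congr_ae (ae_of_all _ fun v => ?_)
  by_cases hv : 0 ≤ v
  · simp [gammaPDF, gammaPDFReal, hv, Real.exp_nonneg]
  · simp [gammaPDF, gammaPDFReal, hv]

/-- The substitution `v = t² / 2`. -/
theorem integral_expMeasure_sqrt (g : ℝ → ℝ) :
    ∫ v, g (√(2 * v)) ∂(expMeasure 1)
      = ∫ t in Set.Ioi 0, t * Real.exp (-(t ^ 2 / 2)) * g t := by
  have himage : (fun t : ℝ => t ^ 2 / 2) '' Set.Ioi 0 = Set.Ioi 0 := by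
    ext v
    simp only [Set.mem_image, Set.mem_Ioi]
    constructor
    · rintro ⟨t, ht, rfl⟩
      positivity
    · intro hv
      refine ⟨√(2 * v), Real.sqrt_pos.2 (by linarith), ?_⟩
      rw [Real.sq_sqrt (by linarith)]
      ring
  have hinj : Set.InjOn (fun t : ℝ => t ^ 2 / 2) (Set.Ioi 0) := by
    intro a ha b hb hab
    have ha' : 0 < a := ha
    have hb' : 0 < b := hb
    have : a ^ 2 = b ^ 2 := by simpa using hab
    exact (pow_left_inj₀ ha'.le hb'.le two_ne_zero).1 this
  have hd : ∀ t ∈ Set.Ioi (0 : ℝ), HasDerivWithinAt (fun t : ℝ => t ^ 2 / 2) t (Set.Ioi 0) t := by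
    intro t _
    refine (((hasDerivAt_id t).pow 2).div_const 2).hasDerivWithinAt.congr_deriv ?_
    simp
  rw [integral_expMeasure_one, ← himage,
    integral_image_eq_integral_abs_deriv_smul measurableSet_Ioi hd hinj]
  rw [himage]
  refine setIntegral_congr_fun measurableSet_Ioi fun t ht => ?_
  have ht' : 0 < t := ht
  have h2 : 2 * (t ^ 2 / 2) = t ^ 2 := by ring
  simp only [h2, Real.sqrt_sq ht'.le, abs_of_pos ht', smul_eq_mul]
  ring

theorem integrable_one_add_sq_mul_exp_neg :
    Integrable fun u : ℝ => (1 + u ^ 2) * Real.exp (-(u ^ 2 / 4)) := by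
  have h1 := integrable_exp_neg_mul_sq (b := 1 / 4) (by norm_num)
  have h2 := integrable_rpow_mul_exp_neg_mul_sq (b := 1 / 4) (by norm_num) (s := 2) (by norm_num)
  refine (h1.add h2).congr (ae_of_all _ fun u => ?_)
  have : -(u ^ 2 / 4) = -(1 / 4) * u ^ 2 := by ring
  simp only [Pi.add_apply, Real.rpow_two, this]
  ring

theorem gaussianPDFReal_zero_one (u : ℝ) :
    gaussianPDFReal 0 1 u = (√(2 * Real.pi))⁻¹ * Real.exp (-(u ^ 2 / 2)) := by
  simp [gaussianPDFReal, neg_div]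

/-- The weight `(1 + |u|)²` dominates both `k` and `u ↦ (u - ε) k u` for `|ε| ≤ 1`. -/
theorem gaussian_shift_bound {k : ℝ → ℝ} {A B : ℝ} (hA : 0 ≤ A) (hB : 0 ≤ B)
    (hk : ∀ t, |k t| ≤ A + B * |t|) {ε : ℝ} (hε : |ε| ≤ 1) {w u : ℝ} (hw : |w| ≤ 1 + |u|) :
    |w * (Real.exp (-((u - ε) ^ 2 / 2)) * k u)|
      ≤ 2 * (A + B) * Real.exp (1 / 2) * ((1 + u ^ 2) * Real.exp (-(u ^ 2 / 4))) := by
  -- Completing the square: `(u - ε)²/2 - u²/4 + 1/2 = (u - 2ε)²/4 + (1 - ε²)/2`.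
  have h1 : Real.exp (-((u - ε) ^ 2 / 2)) ≤ Real.exp (1 / 2) * Real.exp (-(u ^ 2 / 4)) := by
    rw [← Real.exp_add, Real.exp_le_exp]
    have : ε ^ 2 ≤ 1 := (sq_le_one_iff_abs_le_one ε).2 hε
    nlinarith [sq_nonneg (u - 2 * ε)]
  have h2 : |w| * |k u| ≤ 2 * (A + B) * (1 + u ^ 2) := by
    calc |w| * |k u| ≤ (1 + |u|) * (A + B * |u|) := by
          gcongr
          exact hk u
      _ ≤ (1 + |u|) * ((A + B) * (1 + |u|)) := by
          have := abs_nonneg u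
          gcongr
          nlinarith
      _ = (A + B) * (1 + |u|) ^ 2 := by ring
      _ ≤ (A + B) * (2 * (1 + u ^ 2)) := by
          gcongr
          nlinarith [sq_nonneg (1 - |u|), sq_abs u]
      _ = 2 * (A + B) * (1 + u ^ 2) := by ring
  calc |w * (Real.exp (-((u - ε) ^ 2 / 2)) * k u)|
      = |w| * |k u| * Real.exp (-((u - ε) ^ 2 / 2)) := by
        rw [abs_mul, abs_mul, abs_of_pos (Real.exp_pos _)]
        ring
    _ ≤ 2 * (A + B) * (1 + u ^ 2) * (Real.exp (1 / 2) * Real.exp (-(u ^ 2 / 4))) := by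
        gcongr
    _ = _ := by ring

section Stein

variable {k : ℝ → ℝ} {A B : ℝ}

/-- Translation moves `ε` from `k`, which is only measurable, to the smooth density, so that the
average can be differentiated in `ε`. -/
theorem integral_gaussianReal_shift (ε : ℝ) :
    ∫ t, k (ε + t) ∂(gaussianReal 0 1)
      = ∫ u, (√(2 * Real.pi))⁻¹ * (Real.exp (-((u - ε) ^ 2 / 2)) * k u) := by
  rw [integral_gaussianReal_eq_integral_smul one_ne_zero,
    ← integral_sub_right_eq_self _ ε]
  refine integral_congr_ae (ae_of_all _ fun u => ?_)
  simp only [gaussianPDFReal_zero_one, smul_eq_mul, add_sub_cancel]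
  ring

/-- The negative half-line is reflected onto the positive one. There `u exp(-u²/2)` is exactly the
density of `√(2V)` with `V ∼ Exp(1)`, which explains the exponential shift in the estimator. -/
theorem integral_mul_gaussian_eq_expMeasure (hk_meas : Measurable k) (hA : 0 ≤ A) (hB : 0 ≤ B)
    (hk : ∀ t, |k t| ≤ A + B * |t|) :
    ∫ u, u * (Real.exp (-(u ^ 2 / 2)) * k u)
      = ∫ v, (k (√(2 * v)) - k (-√(2 * v))) ∂(expMeasure 1) := by
  have hi : Integrable fun u : ℝ => u * (Real.exp (-(u ^ 2 / 2)) * k u) := by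
    refine (integrable_one_add_sq_mul_exp_neg.const_mul
      (2 * (A + B) * Real.exp (1 / 2))).mono' (by fun_prop) (ae_of_all _ fun u => ?_)
    have := gaussian_shift_bound (ε := 0) hA hB hk (by simp) (w := u) (u := u)
      (by linarith [abs_nonneg u])
    simpa using this
  have hneg : ∫ u in Set.Iic 0, u * (Real.exp (-(u ^ 2 / 2)) * k u)
      = ∫ u in Set.Ioi 0, -u * (Real.exp (-(u ^ 2 / 2)) * k (-u)) := by
    have := integral_comp_neg_Ioi 0 (fun u : ℝ => u * (Real.exp (-(u ^ 2 / 2)) * k u))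
    simpa using this.symm
  have hi' : IntegrableOn (fun u : ℝ => -u * (Real.exp (-(u ^ 2 / 2)) * k (-u))) (Set.Ioi 0) := by
    have := hi.comp_neg
    simp only [neg_sq] at this
    exact this.integrableOn
  rw [integral_expMeasure_sqrt (fun t => k t - k (-t)),
    ← integral_add_compl (s := Set.Ioi (0 : ℝ)) measurableSet_Ioi hi, Set.compl_Ioi, hneg,
    ← integral_add hi.integrableOn hi']
  refine integral_congr_ae (ae_of_all _ fun u => ?_)
  simp only
  ring

/-- Stein's identity for a Gaussian average, with the derivative written as a difference
quotient at an exponentially distributed scale. -/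
theorem hasDerivAt_integral_gaussianReal_shift (hk_meas : Measurable k) (hA : 0 ≤ A) (hB : 0 ≤ B)
    (hk : ∀ t, |k t| ≤ A + B * |t|) :
    HasDerivAt (fun ε => ∫ t, k (ε + t) ∂(gaussianReal 0 1))
      ((√(2 * Real.pi))⁻¹ * ∫ v, (k (√(2 * v)) - k (-√(2 * v))) ∂(expMeasure 1)) 0 := by
  simp only [integral_gaussianReal_shift, integral_const_mul]
  refine HasDerivAt.const_mul _ ?_
  rw [← integral_mul_gaussian_eq_expMeasure hk_meas hA hB hk]
  have key := (hasDerivAt_integral_of_dominated_loc_of_deriv_le (μ := volume) (x₀ := (0 : ℝ))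
    (s := Metric.ball 0 1) (F := fun ε u => Real.exp (-((u - ε) ^ 2 / 2)) * k u)
    (F' := fun ε u => (u - ε) * (Real.exp (-((u - ε) ^ 2 / 2)) * k u))
    (bound := fun u => 2 * (A + B) * Real.exp (1 / 2) * ((1 + u ^ 2) * Real.exp (-(u ^ 2 / 4))))
    (Metric.ball_mem_nhds _ one_pos) (Eventually.of_forall fun ε => by fun_prop) ?_
    (by fun_prop) ?_ (integrable_one_add_sq_mul_exp_neg.const_mul _) ?_).2
  · simpa using key
  · refine (integrable_one_add_sq_mul_exp_neg.const_mul
      (2 * (A + B) * Real.exp (1 / 2))).mono' (by fun_prop) (ae_of_all _ fun u => ?_)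
    have := gaussian_shift_bound (ε := 0) hA hB hk (by simp) (w := 1) (u := u)
      (by simp)
    simpa using this
  · refine ae_of_all _ fun u ε hε => ?_
    have hε' : |ε| ≤ 1 := by
      rw [Metric.mem_ball, dist_zero_right, Real.norm_eq_abs] at hε
      exact hε.le
    refine gaussian_shift_bound hA hB hk hε' ?_
    have := abs_sub u ε
    linarith
  · refine ae_of_all _ fun u ε _ => ?_
    have h1 : HasDerivAt (fun ε : ℝ => -((u - ε) ^ 2 / 2)) (u - ε) ε := by
      refine ((((hasDerivAt_id ε).const_sub u).pow 2).div_const 2).neg.congr_deriv ?_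
      simp
      ring
    refine (h1.exp.mul_const (k u)).congr_deriv ?_
    ring

end Stein

/-! ### Gaussian smoothing of a Lipschitz convex function -/

/-! ### Resampling one Gaussian coordinate, and the geometry of shifted points -/

section Resampling

variable {n : ℕ}

/-- Resampling one coordinate of a product measure does not change the law. -/
theorem measurePreserving_update_pi {ι : Type*} [Fintype ι] [DecidableEq ι] {α : ι → Type*}
    [∀ i, MeasurableSpace (α i)] (μ : ∀ i, Measure (α i)) [∀ i, IsProbabilityMeasure (μ i)]
    (i : ι) :
    MeasurePreserving (fun p : (∀ j, α j) × α i => Function.update p.1 i p.2)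
      ((Measure.pi μ).prod (μ i)) (Measure.pi μ) := by
  have hm : Measurable fun p : (∀ j, α j) × α i => Function.update p.1 i p.2 :=
    measurable_update'
  refine ⟨hm, (Measure.pi_eq fun s hs => ?_).symm⟩
  have hpre : (fun p : (∀ j, α j) × α i => Function.update p.1 i p.2) ⁻¹' Set.univ.pi s
      = (Set.univ.pi (Function.update s i Set.univ)) ×ˢ s i := by
    ext ⟨z, t⟩
    simp only [Set.mem_preimage, Set.mem_univ_pi, Set.mem_prod]
    constructor
    · intro h
      refine ⟨fun j => ?_, by simpa using h i⟩
      rcases eq_or_ne j i with rfl | hj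
      · simp
      · simpa [hj] using h j
    · rintro ⟨h1, h2⟩ j
      rcases eq_or_ne j i with rfl | hj
      · simpa using h2
      · simpa [hj] using h1 j
  rw [Measure.map_apply hm (MeasurableSet.univ_pi hs), hpre, Measure.prod_prod, Measure.pi_pi,
    ← Finset.mul_prod_erase _ _ (Finset.mem_univ i),
    ← Finset.mul_prod_erase Finset.univ (fun j => μ j (s j)) (Finset.mem_univ i)]
  simp only [Function.update_self, measure_univ, one_mul]
  rw [mul_comm]
  congr 1
  refine Finset.prod_congr rfl fun j hj => ?_
  rw [Function.update_of_ne (Finset.ne_of_mem_erase hj)]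

/-- The sign is the one in `shiftedPoint`, where coordinate `i` moves by `+t` and the others by `-z
j`; it is harmless because the Gaussian is symmetric. -/
theorem measurePreserving_update_stdGaussian (i : Fin n) :
    MeasurePreserving
      (fun p : Vec n × ℝ => (WithLp.toLp 2 (Function.update p.1.ofLp i (-p.2)) : Vec n))
      ((stdGaussian (Vec n)).prod (gaussianReal 0 1)) (stdGaussian (Vec n)) := by
  have h1 : MeasurePreserving (WithLp.toLp 2 : (Fin n → ℝ) → Vec n)
      (Measure.pi fun _ => gaussianReal 0 1) (stdGaussian (Vec n)) :=
    ⟨by fun_prop, map_pi_eq_stdGaussian⟩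
  have h2 : MeasurePreserving (WithLp.ofLp : Vec n → (Fin n → ℝ)) (stdGaussian (Vec n))
      (Measure.pi fun _ => gaussianReal 0 1) := by
    refine ⟨by fun_prop, ?_⟩
    rw [← map_pi_eq_stdGaussian, Measure.map_map (by fun_prop) (by fun_prop)]
    exact Measure.map_id
  have h3 : MeasurePreserving (fun t : ℝ => -t) (gaussianReal 0 1) (gaussianReal 0 1) :=
    ⟨by fun_prop, by rw [gaussianReal_map_neg, neg_zero]⟩
  exact h1.comp ((measurePreserving_update_pi (fun _ : Fin n => gaussianReal 0 1) i).comp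
    (h2.prod h3))

theorem shiftedPoint_eq_sub_update (i : Fin n) (ε η t : ℝ) (x z : Vec n) :
    shiftedPoint i (ε + η * t) x (η • z)
      = x + ε • EuclideanSpace.single i (1 : ℝ)
        - η • (WithLp.toLp 2 (Function.update z.ofLp i (-t)) : Vec n) := by
  ext j
  rcases eq_or_ne j i with rfl | hj
  · simp [shiftedPoint]
    ring
  · simp [shiftedPoint, hj]

theorem shiftedPoint_sub_shiftedPoint (i : Fin n) (t t' : ℝ) (x z : Vec n) :
    shiftedPoint i t x z - shiftedPoint i t' x z = EuclideanSpace.single i (t - t') := by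
  ext j
  rcases eq_or_ne j i with rfl | hj <;> simp [shiftedPoint, *]

theorem norm_shiftedPoint_sub (i : Fin n) (t t' : ℝ) (x z : Vec n) :
    ‖shiftedPoint i t x z - shiftedPoint i t' x z‖ = |t - t'| := by
  rw [shiftedPoint_sub_shiftedPoint, PiLp.norm_single, Real.norm_eq_abs]

theorem measurable_shiftedPoint (i : Fin n) :
    Measurable fun q : ℝ × Vec n × Vec n => shiftedPoint i q.1 q.2.1 q.2.2 := by
  unfold shiftedPoint
  refine (WithLp.measurable_toLp 2 _).comp (measurable_pi_lambda _ fun j => ?_)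
  by_cases h : j = i
  · simp only [h, if_true]
    fun_prop
  · simp only [h, if_false]
    fun_prop

end Resampling

/-! ### The second moment of a standard Gaussian vector -/

section Moments

variable {n : ℕ}

theorem integral_norm_sq_stdGaussian :
    Integrable (fun z : Vec n => ‖z‖ ^ 2) (stdGaussian (Vec n)) ∧
      ∫ z, ‖z‖ ^ 2 ∂(stdGaussian (Vec n)) = n := by
  have hLp : ∀ i : Fin n, MemLp (fun z : Vec n => z i) 2 (stdGaussian (Vec n)) := fun i =>
    IsGaussian.memLp_dual (stdGaussian (Vec n)) (EuclideanSpace.proj i) 2 (by simp)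
  have hcoord : ∀ i : Fin n, ∫ z : Vec n, z i ^ 2 ∂(stdGaussian (Vec n)) = 1 := by
    intro i
    have hm := integral_strongDual_stdGaussian (E := Vec n) (EuclideanSpace.proj i)
    have hv := variance_dual_stdGaussian (E := Vec n) (innerSL ℝ (EuclideanSpace.single i 1))
    have hp : (innerSL ℝ (EuclideanSpace.single i (1 : ℝ)) : Vec n → ℝ) = fun z => z i := by
      ext z
      simp [EuclideanSpace.inner_single_left]
    rw [hp, innerSL_apply_norm, PiLp.norm_single,
      variance_of_integral_eq_zero (hLp i).aemeasurable (by simpa using hm)] at hv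
    simpa using hv
  have hi : ∀ i ∈ (Finset.univ : Finset (Fin n)),
      Integrable (fun z : Vec n => z i ^ 2) (stdGaussian (Vec n)) := fun i _ => (hLp i).integrable_sq
  simp only [EuclideanSpace.real_norm_sq_eq]
  exact ⟨integrable_finsetSum _ hi, by rw [integral_finsetSum _ hi]; simp [hcoord]⟩

end Moments

/-- The Gaussian smoothing `x ↦ 𝔼[f(x - η Z)]`, with `Z` a standard Gaussian vector. -/
noncomputable def gaussianSmoothing {n : ℕ} (η : ℝ) (f : Vec n → ℝ) (x : Vec n) : ℝ :=
  ∫ z, f (x - η • z) ∂(stdGaussian (Vec n))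

/-- The `i`-th partial derivative of `gaussianSmoothing η f` at `x`. -/
noncomputable def smoothedPartial {n : ℕ} (η : ℝ) (f : Vec n → ℝ) (x : Vec n) (i : Fin n) : ℝ :=
  ∫ z, ∫ v, (1 / (η * √(2 * Real.pi))) *
      (f (shiftedPoint i (η * √(2 * v)) x (η • z))
        - f (shiftedPoint i (-(η * √(2 * v))) x (η • z))) ∂(expMeasure 1) ∂(stdGaussian (Vec n))

/-! ### Convexity, bias and partial derivatives of the Gaussian smoothing -/

section Smoothing

variable {n : ℕ} {f : Vec n → ℝ} {L η : ℝ}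

theorem continuous_of_abs_sub_le (hf : ∀ x y, |f x - f y| ≤ L * ‖x - y‖) : Continuous f := by
  refine (LipschitzWith.of_dist_le_mul (K := L.toNNReal) fun x y => ?_).continuous
  rw [Real.dist_eq, dist_eq_norm]
  exact (hf x y).trans (by gcongr; exact Real.le_coe_toNNReal L)

theorem integrable_comp_sub_smul (hf : ∀ x y, |f x - f y| ≤ L * ‖x - y‖) (x : Vec n) :
    Integrable (fun z => f (x - η • z)) (stdGaussian (Vec n)) := by
  have hcont := continuous_of_abs_sub_le hf
  have hid : Integrable (fun z : Vec n => z) (stdGaussian (Vec n)) := IsGaussian.integrable_id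
  refine ((integrable_const |f x|).add (hid.norm.const_mul (L * |η|))).mono'
    (by fun_prop) (ae_of_all _ fun z => ?_)
  have h := hf (x - η • z) x
  rw [sub_sub_cancel_left, norm_neg, norm_smul, Real.norm_eq_abs] at h
  have := abs_sub_abs_le_abs_sub (f (x - η • z)) (f x)
  simp only [Real.norm_eq_abs, Pi.add_apply]
  linarith

theorem convexOn_gaussianSmoothing (hf : ∀ x y, |f x - f y| ≤ L * ‖x - y‖)
    (hconv : ConvexOn ℝ Set.univ f) : ConvexOn ℝ Set.univ (gaussianSmoothing η f) := by
  refine ⟨convex_univ, fun x _ y _ a b ha hb hab => ?_⟩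
  have hx := integrable_comp_sub_smul (η := η) hf x
  have hy := integrable_comp_sub_smul (η := η) hf y
  simp only [gaussianSmoothing, smul_eq_mul, ← integral_const_mul]
  rw [← integral_add (hx.const_mul a) (hy.const_mul b)]
  refine integral_mono (integrable_comp_sub_smul hf _) ((hx.const_mul a).add (hy.const_mul b))
    fun z => ?_
  have := hconv.2 (Set.mem_univ (x - η • z)) (Set.mem_univ (y - η • z)) ha hb hab
  have he : a • (x - η • z) + b • (y - η • z) = a • x + b • y - η • z := by
    have h1 : η • z = a • (η • z) + b • (η • z) := by rw [← add_smul, hab, one_smul]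
    nth_rewrite 3 [h1]
    rw [smul_sub, smul_sub]
    abel
  rwa [he] at this

/-- Jensen's inequality, as `x - η • z` has mean `x`. -/
theorem le_gaussianSmoothing (hf : ∀ x y, |f x - f y| ≤ L * ‖x - y‖)
    (hconv : ConvexOn ℝ Set.univ f) (x : Vec n) : f x ≤ gaussianSmoothing η f x := by
  have hid : Integrable (fun z : Vec n => z) (stdGaussian (Vec n)) := IsGaussian.integrable_id
  have hid' : Integrable (fun z : Vec n => η • z) (stdGaussian (Vec n)) := hid.smul η
  have hi : Integrable (fun z : Vec n => x - η • z) (stdGaussian (Vec n)) :=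
    (integrable_const x).sub hid'
  have h := hconv.map_integral_le (continuous_of_abs_sub_le hf).continuousOn isClosed_univ
    (ae_of_all _ fun z => Set.mem_univ _) hi (integrable_comp_sub_smul hf x)
  rw [integral_sub (integrable_const x) hid', integral_smul, integral_id_stdGaussian] at h
  simpa [gaussianSmoothing] using h

theorem gaussianSmoothing_le (hf : ∀ x y, |f x - f y| ≤ L * ‖x - y‖) (hL : 0 ≤ L) (hη : 0 ≤ η)
    (x : Vec n) : gaussianSmoothing η f x ≤ f x + L * η * ((1 + n) / 2) := by
  obtain ⟨hi, hn⟩ := integral_norm_sq_stdGaussian (n := n)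
  have hi' : Integrable (fun z : Vec n => L * η * ((1 + ‖z‖ ^ 2) / 2)) (stdGaussian (Vec n)) :=
    (((integrable_const _).add hi).div_const 2).const_mul _
  calc gaussianSmoothing η f x
      ≤ ∫ z, (f x + L * η * ((1 + ‖z‖ ^ 2) / 2)) ∂(stdGaussian (Vec n)) := by
        refine integral_mono (integrable_comp_sub_smul hf x) ((integrable_const _).add hi')
          fun z => ?_
        have h := le_of_abs_le (hf (x - η • z) x)
        rw [sub_sub_cancel_left, norm_neg, norm_smul, Real.norm_eq_abs, abs_of_nonneg hη] at h
        -- The bound `‖z‖ ≤ (1 + ‖z‖²)/2` needs only the second moment. It gives a bias linear in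
        -- `n`, which the claimed rate allows.
        have h2 : L * (η * ‖z‖) ≤ L * η * ((1 + ‖z‖ ^ 2) / 2) := by
          rw [← mul_assoc]
          gcongr
          nlinarith [sq_nonneg (1 - ‖z‖)]
        simp only
        linarith
    _ = f x + L * η * ((1 + n) / 2) := by
        rw [integral_add (integrable_const _) hi', integral_const_mul,
          integral_div, integral_add (integrable_const _) hi, hn]
        simp

/-- Resampling coordinate `i` turns the smoothing into an average over `z` of one-dimensional
Gaussian averages, to which Stein's identity applies for each fixed `z`. No differentiability of `f`
is needed. -/
theorem hasDerivAt_gaussianSmoothing (hf : ∀ x y, |f x - f y| ≤ L * ‖x - y‖) (hL : 0 ≤ L)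
    (hη : 0 < η) (x : Vec n) (i : Fin n) :
    HasDerivAt (fun ε : ℝ => gaussianSmoothing η f (x + ε • EuclideanSpace.single i (1 : ℝ)))
      (smoothedPartial η f x i) 0 := by
  have hcont := continuous_of_abs_sub_le hf
  have hshift := measurable_shiftedPoint (n := n) i
  have : IsProbabilityMeasure (expMeasure 1) := isProbabilityMeasure_expMeasure one_pos
  have hMP := measurePreserving_update_stdGaussian (n := n) i
  have hint : ∀ ε : ℝ, Integrable (fun p : Vec n × ℝ =>
      f (shiftedPoint i (ε + η * p.2) x (η • p.1)))
      ((stdGaussian (Vec n)).prod (gaussianReal 0 1)) := by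
    intro ε
    simp only [shiftedPoint_eq_sub_update]
    exact hMP.integrable_comp_of_integrable (integrable_comp_sub_smul hf _)
  have hsm : ∀ ε : ℝ, gaussianSmoothing η f (x + ε • EuclideanSpace.single i (1 : ℝ))
      = ∫ z, ∫ t, f (shiftedPoint i (ε + η * t) x (η • z)) ∂(gaussianReal 0 1)
          ∂(stdGaussian (Vec n)) := by
    intro ε
    rw [← integral_prod _ (hint ε), gaussianSmoothing]
    simp only [shiftedPoint_eq_sub_update]
    conv_lhs => rw [← hMP.map_eq]
    rw [integral_map hMP.measurable.aemeasurable (by fun_prop)]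
  have hfsh : ∀ z t t', |f (shiftedPoint i t x z) - f (shiftedPoint i t' x z)| ≤ L * |t - t'| := by
    intro z t t'
    rw [← norm_shiftedPoint_sub i t t' x z]
    exact hf _ _
  have hmz : ∀ z : Vec n, Measurable fun s : ℝ => f (shiftedPoint i s x z) := fun z =>
    hcont.measurable.comp
      (hshift.comp (by fun_prop : Measurable fun s : ℝ => (s, x, z)))
  have hpoint : ∀ z : Vec n, HasDerivAt
      (fun ε => ∫ t, f (shiftedPoint i (ε + η * t) x (η • z)) ∂(gaussianReal 0 1))
      (∫ v, (1 / (η * √(2 * Real.pi))) *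
        (f (shiftedPoint i (η * √(2 * v)) x (η • z))
          - f (shiftedPoint i (-(η * √(2 * v))) x (η • z))) ∂(expMeasure 1)) 0 := by
    intro z
    have hk := hasDerivAt_integral_gaussianReal_shift
      (k := fun s => f (shiftedPoint i (η * s) x (η • z)))
      (A := |f (shiftedPoint i 0 x (η • z))|) (B := L * η)
      ((hmz (η • z)).comp (measurable_const_mul η)) (abs_nonneg _) (by positivity) (fun t => by
        have h1 := hfsh (η • z) (η * t) 0
        rw [sub_zero, abs_mul, abs_of_pos hη] at h1
        have := abs_sub_abs_le_abs_sub (f (shiftedPoint i (η * t) x (η • z)))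
          (f (shiftedPoint i 0 x (η • z)))
        linarith)
    -- Since `ε + η t = η (ε/η + t)`, Stein's identity is used at the shift `ε/η`, whence the factor
    -- `1/η`.
    have hdiv : HasDerivAt (fun ε : ℝ => ε / η) (1 / η) 0 := (hasDerivAt_id 0).div_const η
    have hcomp := HasDerivAt.comp (0 : ℝ) (by rw [zero_div]; exact hk) hdiv
    refine (hcomp.congr_deriv ?_).congr_of_eventuallyEq (Eventually.of_forall fun ε => ?_)
    · rw [integral_const_mul]
      simp only [mul_neg]
      field_simp
    · simp only [Function.comp_apply]
      refine integral_congr_ae (ae_of_all _ fun t => ?_)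
      simp only
      rw [mul_add, mul_div_cancel₀ _ hη.ne']
  simp only [hsm]
  -- The inner averages are `L`-Lipschitz in `ε` uniformly in `z`, which dominates the difference
  -- quotients in the outer integral.
  refine (hasDerivAt_integral_of_dominated_loc_of_lip (bound := fun _ => L) univ_mem
    (Eventually.of_forall fun ε => (hint ε).integral_prod_left.aestronglyMeasurable)
    (hint 0).integral_prod_left ?_ (ae_of_all _ fun z => ?_) (integrable_const L)
    (ae_of_all _ hpoint)).2
  · refine (StronglyMeasurable.integral_prod_right (f := fun (z : Vec n) (v : ℝ) =>
      (1 / (η * √(2 * Real.pi))) * (f (shiftedPoint i (η * √(2 * v)) x (η • z))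
        - f (shiftedPoint i (-(η * √(2 * v))) x (η • z)))) ?_).aestronglyMeasurable
    refine Measurable.stronglyMeasurable (Measurable.const_mul (Measurable.sub ?_ ?_) _)
    · exact hcont.measurable.comp (hshift.comp (by fun_prop :
        Measurable fun p : Vec n × ℝ => (η * √(2 * p.2), x, η • p.1)))
    · exact hcont.measurable.comp (hshift.comp (by fun_prop :
        Measurable fun p : Vec n × ℝ => (-(η * √(2 * p.2)), x, η • p.1)))
  · refine LipschitzWith.lipschitzOnWith (LipschitzWith.of_dist_le_mul fun ε ε' => ?_)
    have hti : ∀ ε : ℝ, Integrable (fun t => f (shiftedPoint i (ε + η * t) x (η • z)))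
        (gaussianReal 0 1) := by
      intro ε
      have hid : Integrable (fun t : ℝ => t) (gaussianReal 0 1) := IsGaussian.integrable_id
      refine ((integrable_const (|f (shiftedPoint i ε x (η • z))|)).add
        (hid.norm.const_mul (L * η))).mono'
        ((hmz (η • z)).comp (by fun_prop)).aestronglyMeasurable (ae_of_all _ fun t => ?_)
      have h1 := hfsh (η • z) (ε + η * t) ε
      rw [add_sub_cancel_left, abs_mul, abs_of_pos hη] at h1
      have := abs_sub_abs_le_abs_sub (f (shiftedPoint i (ε + η * t) x (η • z)))
        (f (shiftedPoint i ε x (η • z)))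
      simp only [Real.norm_eq_abs, Pi.add_apply]
      linarith
    rw [Real.dist_eq, Real.dist_eq, Real.coe_nnabs, abs_of_nonneg hL,
      ← integral_sub (hti ε) (hti ε')]
    refine (abs_integral_le_integral_abs).trans ?_
    refine (integral_mono ((hti ε).sub (hti ε')).abs (integrable_const (L * |ε - ε'|))
      fun t => ?_).trans ?_
    · have := hfsh (η • z) (ε + η * t) (ε' + η * t)
      rwa [add_sub_add_right_eq_sub] at this
    · simp

end Smoothing

/-- A convex function on `ℝⁿ` lies above the affine function built from its partial
derivatives. -/
theorem ConvexOn.add_sum_partial_le {n : ℕ} {f : Vec n → ℝ} (hf : ConvexOn ℝ Set.univ f)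
    {x : Vec n} {g : Fin n → ℝ}
    (hg : ∀ i, HasDerivAt (fun ε : ℝ => f (x + ε • EuclideanSpace.single i (1 : ℝ))) (g i) 0)
    (y : Vec n) : f x + ∑ i, g i * (y i - x i) ≤ f y := by
  rcases Nat.eq_zero_or_pos n with rfl | hn
  · rw [Subsingleton.elim y x]
    simp
  have hn0 : (n : ℝ) ≠ 0 := by positivity
  -- The `n` points move along the separate axes, and their barycentre is `x - ε • (y - x)`. Jensen
  -- therefore bounds `f` there by `ψ ε`, whose derivative at `0` involves partial derivatives only.
  set ψ : ℝ → ℝ := fun ε => ∑ i : Fin n, (n : ℝ)⁻¹ *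
    f (x + ((-(n * (y i - x i))) * ε) • EuclideanSpace.single i (1 : ℝ)) with hψ
  have hψd : HasDerivAt ψ (-∑ i, g i * (y i - x i)) 0 := by
    have h := HasDerivAt.fun_sum (u := Finset.univ) (x := (0 : ℝ))
      (A := fun (i : Fin n) (ε : ℝ) => (n : ℝ)⁻¹ *
        f (x + ((-(n * (y i - x i))) * ε) • EuclideanSpace.single i (1 : ℝ)))
      (A' := fun i => (n : ℝ)⁻¹ * (g i * (-(n * (y i - x i))))) (fun i _ => by
        refine HasDerivAt.const_mul _ ?_
        have hlin : HasDerivAt (fun ε : ℝ => (-(n * (y i - x i))) * ε) (-(n * (y i - x i))) 0 := by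
          simpa using (hasDerivAt_id (0 : ℝ)).const_mul (-(n * (y i - x i)))
        exact HasDerivAt.comp (0 : ℝ) (by rw [mul_zero]; exact hg i) hlin)
    refine h.congr_deriv ?_
    rw [← Finset.sum_neg_distrib]
    refine Finset.sum_congr rfl fun i _ => ?_
    field_simp
  have hψ0 : ψ 0 = f x := by
    simp only [hψ, mul_zero, zero_smul, add_zero, Finset.sum_const, Finset.card_univ,
      Fintype.card_fin, nsmul_eq_mul]
    field_simp
  have hle : ∀ ε : ℝ, f (x - ε • (y - x)) ≤ ψ ε := by
    intro ε
    have h := hf.map_sum_le (t := Finset.univ) (w := fun _ : Fin n => (n : ℝ)⁻¹)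
      (p := fun i => x + ((-(n * (y i - x i))) * ε) • EuclideanSpace.single i (1 : ℝ))
      (fun _ _ => by positivity) (by simp [hn0]) (fun _ _ => Set.mem_univ _)
    have hp : ∑ i : Fin n, (n : ℝ)⁻¹ •
        (x + ((-(n * (y i - x i))) * ε) • EuclideanSpace.single i (1 : ℝ)) = x - ε • (y - x) := by
      ext j
      simp only [WithLp.ofLp_sum, Finset.sum_apply, PiLp.smul_apply, PiLp.add_apply,
        PiLp.sub_apply, PiLp.single_apply, smul_eq_mul, mul_add, Finset.sum_add_distrib,
        Finset.sum_const, Finset.card_univ, Fintype.card_fin, nsmul_eq_mul]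
      simp only [mul_ite, mul_one, mul_zero, Finset.sum_ite_eq, Finset.mem_univ, if_true]
      field_simp
      ring
    rwa [hp] at h
  -- The point `x` lies between `y` and `x - ε • (y - x)`; convexity on this segment bounds `f x - f
  -- y` by a slope of `ψ`, and `ε → 0⁺` finishes the proof.
  have hslope : ∀ ε : ℝ, 0 < ε → f x - f y ≤ ε⁻¹ * (ψ ε - ψ 0) := by
    intro ε hε
    have h1 : (0 : ℝ) < 1 + ε := by linarith
    have ha : 0 ≤ ε / (1 + ε) := by positivity
    have hb : 0 ≤ 1 / (1 + ε) := by positivity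
    have hab : ε / (1 + ε) + 1 / (1 + ε) = 1 := by
      field_simp
      ring
    have h := hf.2 (Set.mem_univ y) (Set.mem_univ (x - ε • (y - x))) ha hb hab
    have hp : (ε / (1 + ε)) • y + (1 / (1 + ε)) • (x - ε • (y - x)) = x := by
      ext j
      simp only [PiLp.smul_apply, PiLp.add_apply, PiLp.sub_apply, smul_eq_mul]
      field_simp
      ring
    rw [hp, smul_eq_mul, smul_eq_mul] at h
    have h2 : (1 + ε) * f x ≤ ε * f y + f (x - ε • (y - x)) := by
      calc (1 + ε) * f x ≤ (1 + ε) * (ε / (1 + ε) * f y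
            + 1 / (1 + ε) * f (x - ε • (y - x))) := by gcongr
        _ = ε * f y + f (x - ε • (y - x)) := by field_simp
    rw [← div_eq_inv_mul, le_div_iff₀ hε, hψ0]
    nlinarith [hle ε]
  have hlim := hψd.tendsto_slope_zero_right
  simp only [zero_add, smul_eq_mul] at hlim
  have := ge_of_tendsto hlim (eventually_mem_nhdsWithin.mono fun ε hε => hslope ε hε)
  linarith

/-- The smoothing error enters only at `y`, because the smoothing already lies above `f` at `x`. -/
theorem gaussianSmoothing_add_sum_le {n : ℕ} {f : Vec n → ℝ} {L η : ℝ}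
    (hf : ∀ x y, |f x - f y| ≤ L * ‖x - y‖) (hconv : ConvexOn ℝ Set.univ f) (hL : 0 ≤ L)
    (hη : 0 < η) (x y : Vec n) :
    f x - f y - L * η * ((1 + n) / 2) ≤ ∑ i, smoothedPartial η f x i * (x i - y i) := by
  have h := (convexOn_gaussianSmoothing (η := η) hf hconv).add_sum_partial_le
    (fun i => hasDerivAt_gaussianSmoothing hf hL hη x i) y
  have h1 := le_gaussianSmoothing (η := η) hf hconv x
  have h2 := gaussianSmoothing_le hf hL hη.le y
  have h3 : ∑ i, smoothedPartial η f x i * (x i - y i)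
      = -∑ i, smoothedPartial η f x i * (y i - x i) := by
    rw [← Finset.sum_neg_distrib]
    exact Finset.sum_congr rfl fun i _ => by ring
  linarith

/-! ### Mean and moments of the estimator -/

theorem lintegral_expMeasure_one {g : ℝ → ENNReal} (hg : Measurable g) :
    ∫⁻ v, g v ∂(expMeasure 1) = ∫⁻ v in Set.Ioi 0, ENNReal.ofReal (Real.exp (-v)) * g v := by
  have hm : Measurable (gammaPDF 1 1) := (measurable_gammaPDFReal 1 1).ennreal_ofReal
  rw [expMeasure, gammaMeasure, lintegral_withDensity_eq_lintegral_mul _ hm hg,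
    setLIntegral_congr Ioi_ae_eq_Ici, ← lintegral_indicator measurableSet_Ici]
  refine lintegral_congr fun v => ?_
  by_cases hv : 0 ≤ v
  · simp [gammaPDF, gammaPDFReal, hv]
  · simp [gammaPDF, gammaPDFReal, hv]

theorem lintegral_expMeasure_pow (m : ℕ) :
    ∫⁻ v, ENNReal.ofReal ((√(2 * v) ^ 2) ^ m) ∂(expMeasure 1)
      = ENNReal.ofReal (2 ^ m * m.factorial) := by
  have hpos : (0 : ℝ) < (m : ℝ) + 1 := by positivity
  have hi := (Real.GammaIntegral_convergent hpos).const_mul (2 ^ m)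
  rw [lintegral_expMeasure_one (by fun_prop), ← Real.Gamma_nat_eq_factorial,
    Real.Gamma_eq_integral hpos, ← integral_const_mul,
    ofReal_integral_eq_lintegral_ofReal hi]
  · refine setLIntegral_congr_fun measurableSet_Ioi fun v hv => ?_
    have hv' : 0 < v := hv
    rw [Real.sq_sqrt (by linarith), ← ENNReal.ofReal_mul (Real.exp_pos _).le,
      add_sub_cancel_right, Real.rpow_natCast, mul_pow]
    congr 1
    ring
  · refine (ae_restrict_iff' measurableSet_Ioi).2 (ae_of_all _ fun v hv => ?_)
    have hv' : 0 < v := hv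
    simp only [Pi.zero_apply]
    positivity

instance isProbabilityMeasure_expMeasure_one : IsProbabilityMeasure (expMeasure 1) :=
  isProbabilityMeasure_expMeasure one_pos

instance isProbabilityMeasure_gaussianVec (n : ℕ) (η : ℝ) :
    IsProbabilityMeasure (gaussianVec n η) :=
  Measure.isProbabilityMeasure_map (by fun_prop)

section Estimator

variable {n : ℕ} {S : Type*} [MeasurableSpace S] {ν : Measure S} {G : Vec n → S → ℝ}
  {f : Vec n → ℝ} {L₀ η : ℝ}

theorem measurable_esGs (hG : Measurable (Function.uncurry G)) (η : ℝ) :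
    Measurable fun q : Vec n × ℝ × Vec n × S =>
      esGs η (fun y => G y q.2.2.2) q.1 q.2.1 q.2.2.1 := by
  unfold esGs
  refine (WithLp.measurable_toLp 2 _).comp (measurable_pi_lambda _ fun i => ?_)
  refine Measurable.const_mul (Measurable.sub ?_ ?_) _
  · exact hG.comp (((measurable_shiftedPoint i).comp (by fun_prop : Measurable
      fun q : Vec n × ℝ × Vec n × S => (η * √(2 * q.2.1), q.1, q.2.2.1))).prodMk (by fun_prop))
  · exact hG.comp (((measurable_shiftedPoint i).comp (by fun_prop : Measurable
      fun q : Vec n × ℝ × Vec n × S => (-(η * √(2 * q.2.1)), q.1, q.2.2.1))).prodMk (by fun_prop))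

theorem measurable_esGs_section (hG : Measurable (Function.uncurry G)) (η : ℝ) (x : Vec n) :
    Measurable fun w : ℝ × Vec n × S => esGs η (fun y => G y w.2.2) x w.1 w.2.1 :=
  (measurable_esGs hG η).comp measurable_prodMk_left

theorem measurable_esGs_coord (hG : Measurable (Function.uncurry G)) (η : ℝ) (x : Vec n)
    (i : Fin n) : Measurable fun w : ℝ × Vec n × S => esGs η (fun y => G y w.2.2) x w.1 w.2.1 i :=
  (EuclideanSpace.proj (𝕜 := ℝ) i).measurable.comp (measurable_esGs_section hG η x)

variable [IsProbabilityMeasure ν]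

/-- The sample `s` is integrated first, with `v` and `z` frozen. The distance between the two
evaluation points depends on `v` alone, so the bound does too. -/
theorem lintegral_noise_le {F : ℝ × Vec n × S → ENNReal} {h : ℝ → ENNReal} (hF : Measurable F)
    (hle : ∀ v z, ∫⁻ s, F (v, z, s) ∂ν ≤ h v) :
    ∫⁻ w, F w ∂((expMeasure 1).prod ((gaussianVec n η).prod ν)) ≤ ∫⁻ v, h v ∂(expMeasure 1) := by
  rw [lintegral_prod _ hF.aemeasurable]
  refine lintegral_mono fun v => ?_
  have hFv : Measurable fun y => F (v, y) := hF.comp measurable_prodMk_left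
  rw [lintegral_prod _ hFv.aemeasurable]
  calc ∫⁻ z, ∫⁻ s, F (v, z, s) ∂ν ∂(gaussianVec n η)
      ≤ ∫⁻ _, h v ∂(gaussianVec n η) := lintegral_mono fun z => hle v z
    _ = h v := by simp

theorem inv_scale_sq (η : ℝ) :
    (1 / (η * √(2 * Real.pi))) ^ 2 = 1 / (η ^ 2 * (2 * Real.pi)) := by
  rw [div_pow, mul_pow, Real.sq_sqrt (by positivity), one_pow]

theorem esGs_apply (h : Vec n → ℝ) (x : Vec n) (v : ℝ) (z : Vec n) (i : Fin n) :
    esGs η h x v z i = (1 / (η * √(2 * Real.pi))) *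
      (h (shiftedPoint i (η * √(2 * v)) x z) - h (shiftedPoint i (-(η * √(2 * v))) x z)) := rfl

/-- The evaluation points are `2η√(2v)` apart, so `η` cancels against the scale of the estimator;
what remains is `4L₀²/π`. -/
theorem lintegral_esGs_coord_sq_le (hG : Measurable (Function.uncurry G))
    (hsub : SubGaussianIncrements ν G L₀) (hη : 0 < η) (x : Vec n) (i : Fin n) :
    ∫⁻ w, ENNReal.ofReal (esGs η (fun y => G y w.2.2) x w.1 w.2.1 i ^ 2)
      ∂((expMeasure 1).prod ((gaussianVec n η).prod ν)) ≤ ENNReal.ofReal (2 * L₀ ^ 2) := by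
  have hsec : ∀ y y', Measurable fun s => G y s - G y' s := fun y y' =>
    (hG.comp measurable_prodMk_left).sub (hG.comp measurable_prodMk_left)
  have hpi := Real.pi_gt_three
  have hK : 0 ≤ 1 / (2 * Real.pi) * (4 * L₀ ^ 2) := by positivity
  calc _ ≤ ∫⁻ v, ENNReal.ofReal (1 / (2 * Real.pi) * (4 * L₀ ^ 2))
          * ENNReal.ofReal ((√(2 * v) ^ 2) ^ 1) ∂(expMeasure 1) := by
        refine lintegral_noise_le ((measurable_esGs_coord hG η x i).pow_const 2).ennreal_ofReal
          fun v z => ?_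
        have h := lintegral_sq_le_of_exp_sq (hsec _ _)
          (hsub (shiftedPoint i (η * √(2 * v)) x z) (shiftedPoint i (-(η * √(2 * v))) x z))
        rw [norm_shiftedPoint_sub, sq_abs] at h
        simp only [esGs_apply, mul_pow _ (_ - _), inv_scale_sq η]
        simp only [ENNReal.ofReal_mul (show 0 ≤ 1 / (η ^ 2 * (2 * Real.pi)) by positivity)]
        rw [lintegral_const_mul _ ((hsec _ _).pow_const 2).ennreal_ofReal]
        refine (mul_le_mul_right h _).trans_eq ?_
        rw [← ENNReal.ofReal_mul (by positivity), ← ENNReal.ofReal_mul hK]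
        congr 1
        field_simp
        ring
    _ = ENNReal.ofReal (1 / (2 * Real.pi) * (4 * L₀ ^ 2) * 2) := by
        rw [lintegral_const_mul _ (by fun_prop), lintegral_expMeasure_pow,
          ← ENNReal.ofReal_mul hK]
        simp
    _ ≤ ENNReal.ofReal (2 * L₀ ^ 2) := by
        refine ENNReal.ofReal_le_ofReal ?_
        rw [div_mul_eq_mul_div, div_mul_eq_mul_div, div_le_iff₀ (by positivity)]
        nlinarith [sq_nonneg L₀]

/-- With `b` of order `η² v`, the part `b²` cancels the scale `η⁻⁴`, while the part `2b` leaves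
`η⁻²`. -/
theorem lintegral_esGs_coord_fourth_le (hG : Measurable (Function.uncurry G))
    (hsub : SubGaussianIncrements ν G L₀) (hη : 0 < η) (hη1 : η ≤ 1) (x : Vec n) (i : Fin n) :
    ∫⁻ w, ENNReal.ofReal (esGs η (fun y => G y w.2.2) x w.1 w.2.1 i ^ 4)
      ∂((expMeasure 1).prod ((gaussianVec n η).prod ν))
        ≤ ENNReal.ofReal ((L₀ ^ 2 + 4 * L₀ ^ 4) / η ^ 2) := by
  have hsec : ∀ y y', Measurable fun s => G y s - G y' s := fun y y' =>
    (hG.comp measurable_prodMk_left).sub (hG.comp measurable_prodMk_left)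
  have hpi := Real.pi_gt_three
  have hK1 : 0 ≤ 2 * L₀ ^ 2 / (η ^ 2 * Real.pi ^ 2) := by positivity
  have hK2 : 0 ≤ 4 * L₀ ^ 4 / Real.pi ^ 2 := by positivity
  have hscale : (1 / (η * √(2 * Real.pi))) ^ 4 = 1 / (η ^ 4 * (4 * Real.pi ^ 2)) := by
    have : (1 / (η * √(2 * Real.pi))) ^ 4 = ((1 / (η * √(2 * Real.pi))) ^ 2) ^ 2 := by ring
    rw [this, inv_scale_sq η, div_pow]
    congr 1
    ring
    ring
  calc _ ≤ ∫⁻ v, (ENNReal.ofReal (2 * L₀ ^ 2 / (η ^ 2 * Real.pi ^ 2))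
            * ENNReal.ofReal ((√(2 * v) ^ 2) ^ 1)
          + ENNReal.ofReal (4 * L₀ ^ 4 / Real.pi ^ 2)
            * ENNReal.ofReal ((√(2 * v) ^ 2) ^ 2)) ∂(expMeasure 1) := by
        refine lintegral_noise_le ((measurable_esGs_coord hG η x i).pow_const 4).ennreal_ofReal
          fun v z => ?_
        have h := lintegral_fourth_le_of_exp_sq (hsec _ _) (by positivity)
          (hsub (shiftedPoint i (η * √(2 * v)) x z) (shiftedPoint i (-(η * √(2 * v))) x z))
        rw [norm_shiftedPoint_sub, sq_abs] at h
        simp only [esGs_apply, mul_pow _ (_ - _), hscale]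
        simp only [ENNReal.ofReal_mul (show 0 ≤ 1 / (η ^ 4 * (4 * Real.pi ^ 2)) by positivity)]
        rw [lintegral_const_mul _ ((hsec _ _).pow_const 4).ennreal_ofReal]
        refine (mul_le_mul_right h _).trans_eq ?_
        rw [← ENNReal.ofReal_mul (by positivity), ← ENNReal.ofReal_mul hK1,
          ← ENNReal.ofReal_mul hK2, ← ENNReal.ofReal_add (by positivity) (by positivity)]
        congr 1
        field_simp
        ring
    _ = ENNReal.ofReal (2 * L₀ ^ 2 / (η ^ 2 * Real.pi ^ 2) * 2
          + 4 * L₀ ^ 4 / Real.pi ^ 2 * 8) := by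
        rw [lintegral_add_left (by fun_prop), lintegral_const_mul _ (by fun_prop),
          lintegral_const_mul _ (by fun_prop),
          lintegral_expMeasure_pow, lintegral_expMeasure_pow,
          ← ENNReal.ofReal_mul hK1, ← ENNReal.ofReal_mul hK2,
          ← ENNReal.ofReal_add (by positivity) (by positivity)]
        norm_num [Nat.factorial]
    _ ≤ ENNReal.ofReal ((L₀ ^ 2 + 4 * L₀ ^ 4) / η ^ 2) := by
        refine ENNReal.ofReal_le_ofReal ?_
        have hp2 : 9 ≤ Real.pi ^ 2 := by nlinarith
        have h1 : 2 * L₀ ^ 2 / (η ^ 2 * Real.pi ^ 2) * 2 ≤ L₀ ^ 2 / η ^ 2 := by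
          rw [div_mul_eq_mul_div, div_le_div_iff₀ (by positivity) (by positivity)]
          have : 0 ≤ L₀ ^ 2 * η ^ 2 := by positivity
          nlinarith
        have h2 : 4 * L₀ ^ 4 / Real.pi ^ 2 * 8 ≤ 4 * L₀ ^ 4 / η ^ 2 := by
          rw [div_mul_eq_mul_div, div_le_div_iff₀ (by positivity) (by positivity)]
          have h3 : η ^ 2 ≤ 1 := by nlinarith
          have h4 : 8 * η ^ 2 ≤ Real.pi ^ 2 := by linarith
          have : 0 ≤ 4 * L₀ ^ 4 := by positivity
          nlinarith
        rw [add_div]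
        linarith

theorem lintegral_norm_esGs_sq_le (hG : Measurable (Function.uncurry G))
    (hsub : SubGaussianIncrements ν G L₀) (hη : 0 < η) (x : Vec n) :
    ∫⁻ w, ENNReal.ofReal (‖esGs η (fun y => G y w.2.2) x w.1 w.2.1‖ ^ 2)
      ∂((expMeasure 1).prod ((gaussianVec n η).prod ν)) ≤ ENNReal.ofReal (n * (2 * L₀ ^ 2)) := by
  simp only [EuclideanSpace.real_norm_sq_eq,
    ENNReal.ofReal_sum_of_nonneg (fun i _ => sq_nonneg _)]
  rw [lintegral_finsetSum _ fun i _ => ((measurable_esGs_coord hG η x i).pow_const 2).ennreal_ofReal]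
  refine (Finset.sum_le_sum fun i _ => lintegral_esGs_coord_sq_le hG hsub hη x i).trans_eq ?_
  rw [Finset.sum_const, Finset.card_univ, Fintype.card_fin, nsmul_eq_mul,
    ENNReal.ofReal_mul (Nat.cast_nonneg n), ENNReal.ofReal_natCast]

theorem lintegral_norm_esGs_fourth_le (hG : Measurable (Function.uncurry G))
    (hsub : SubGaussianIncrements ν G L₀) (hη : 0 < η) (hη1 : η ≤ 1) (x : Vec n) :
    ∫⁻ w, ENNReal.ofReal (‖esGs η (fun y => G y w.2.2) x w.1 w.2.1‖ ^ 4)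
      ∂((expMeasure 1).prod ((gaussianVec n η).prod ν))
        ≤ ENNReal.ofReal (n ^ 2 * ((L₀ ^ 2 + 4 * L₀ ^ 4) / η ^ 2)) := by
  have hle : ∀ u : Vec n, ENNReal.ofReal (‖u‖ ^ 4) ≤ ∑ i, ENNReal.ofReal (n * u i ^ 4) := by
    intro u
    rw [← ENNReal.ofReal_sum_of_nonneg (fun i _ => by positivity), ← Finset.mul_sum]
    refine ENNReal.ofReal_le_ofReal ?_
    have h := sq_sum_le_card_mul_sum_sq (s := Finset.univ) (f := fun i => u i ^ 2)
    rw [Finset.card_univ, Fintype.card_fin, ← EuclideanSpace.real_norm_sq_eq] at h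
    calc ‖u‖ ^ 4 = (‖u‖ ^ 2) ^ 2 := by ring
      _ ≤ _ := h
      _ = _ := by
        congr 1
        exact Finset.sum_congr rfl fun i _ => by ring
  refine (lintegral_mono fun w => hle _).trans ?_
  rw [lintegral_finsetSum _ fun i _ =>
    (((measurable_esGs_coord hG η x i).pow_const 4).const_mul _).ennreal_ofReal]
  have hi : ∀ i ∈ Finset.univ, ∫⁻ w : ℝ × Vec n × S,
      ENNReal.ofReal (n * esGs η (fun y => G y w.2.2) x w.1 w.2.1 i ^ 4)
      ∂((expMeasure 1).prod ((gaussianVec n η).prod ν))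
        ≤ ENNReal.ofReal (n * ((L₀ ^ 2 + 4 * L₀ ^ 4) / η ^ 2)) := by
    intro i _
    simp only [ENNReal.ofReal_mul (Nat.cast_nonneg (α := ℝ) n)]
    rw [lintegral_const_mul _ ((measurable_esGs_coord hG η x i).pow_const 4).ennreal_ofReal]
    gcongr
    exact lintegral_esGs_coord_fourth_le hG hsub hη hη1 x i
  refine (Finset.sum_le_sum hi).trans_eq ?_
  rw [Finset.sum_const, Finset.card_univ, Fintype.card_fin, nsmul_eq_mul,
    ← ENNReal.ofReal_natCast, ← ENNReal.ofReal_mul (Nat.cast_nonneg n)]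
  congr 1
  ring

theorem integrable_esGs_coord (hG : Measurable (Function.uncurry G))
    (hsub : SubGaussianIncrements ν G L₀) (hη : 0 < η) (x : Vec n) (i : Fin n) :
    Integrable (fun w : ℝ × Vec n × S => esGs η (fun y => G y w.2.2) x w.1 w.2.1 i)
      ((expMeasure 1).prod ((gaussianVec n η).prod ν)) :=
  integrable_of_integrable_sq (measurable_esGs_coord hG η x i)
    (integrable_sq_of_lintegral_le (measurable_esGs_coord hG η x i)
      (lintegral_esGs_coord_sq_le hG hsub hη x i))

/-- The estimator is an unbiased estimator of the gradient of the smoothed objective. -/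
theorem integral_esGs_coord (h : ConvexStochasticModel ν G f)
    (hsub : SubGaussianIncrements ν G L₀) (hη : 0 < η) (x : Vec n) (i : Fin n) :
    ∫ w, esGs η (fun y => G y w.2.2) x w.1 w.2.1 i
      ∂((expMeasure 1).prod ((gaussianVec n η).prod ν)) = smoothedPartial η f x i := by
  -- Reassociation puts the integral over `s` innermost, where it turns `G` into `f`; then the
  -- integrals over `v` and `z` are exchanged.
  have hMP := measurePreserving_prodAssoc (expMeasure 1) (gaussianVec n η) ν
  have hi := hMP.integrable_comp_of_integrable (integrable_esGs_coord h.measurable hsub hη x i)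
  have hs : ∀ p : ℝ × Vec n, ∫ s, ((fun w : ℝ × Vec n × S =>
      esGs η (fun y => G y w.2.2) x w.1 w.2.1 i) ∘ MeasurableEquiv.prodAssoc) (p, s) ∂ν
      = (1 / (η * √(2 * Real.pi))) * (f (shiftedPoint i (η * √(2 * p.1)) x p.2)
        - f (shiftedPoint i (-(η * √(2 * p.1))) x p.2)) := by
    intro p
    rw [h.objective, h.objective, ← integral_sub (h.integrable _) (h.integrable _),
      ← integral_const_mul]
    rfl
  have hi2 := hi.integral_prod_left
  simp only [hs] at hi2
  rw [← hMP.map_eq, integral_map hMP.measurable.aemeasurable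
    (measurable_esGs_coord h.measurable η x i).aestronglyMeasurable]
  calc _ = ∫ p, (1 / (η * √(2 * Real.pi))) * (f (shiftedPoint i (η * √(2 * p.1)) x p.2)
        - f (shiftedPoint i (-(η * √(2 * p.1))) x p.2))
        ∂((expMeasure 1).prod (gaussianVec n η)) := by
        rw [← integral_congr_ae (ae_of_all _ hs)]
        exact integral_prod _ hi
    _ = smoothedPartial η f x i := by
        rw [integral_prod_symm _ hi2]
        exact integral_map (by fun_prop) hi2.integral_prod_right.aestronglyMeasurable

end Estimator

/-! ### The increment of the squared distance along one step -/

/-- An upper bound for the increment of `‖x - a‖²` along a step of length `γ`. -/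
noncomputable def stepIncrement {n : ℕ} {S : Type*} (γ η : ℝ) (G : Vec n → S → ℝ) (a x : Vec n)
    (w : ℝ × Vec n × S) : ℝ :=
  γ ^ 2 * ‖esGs η (fun y => G y w.2.2) x w.1 w.2.1‖ ^ 2
    - 2 * γ * inner ℝ (esGs η (fun y => G y w.2.2) x w.1 w.2.1) (x - a)

section StepIncrement

variable {n : ℕ} {S : Type*} [MeasurableSpace S] {ν : Measure S} {G : Vec n → S → ℝ}
  {f : Vec n → ℝ} {L₀ η γ D : ℝ} {a x : Vec n}

theorem measurable_stepIncrement (hG : Measurable (Function.uncurry G)) (γ η : ℝ) (a : Vec n) :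
    Measurable (Function.uncurry (stepIncrement γ η G a)) := by
  have h := measurable_esGs hG η
  exact ((h.norm.pow_const 2).const_mul _).sub
    ((h.inner (measurable_fst.sub_const a)).const_mul _)

variable [IsProbabilityMeasure ν]

/-- Taking the smoothing radius equal to the step length makes `γ⁴ 𝔼‖g‖⁴` of order `γ²`, like the
inner-product part `γ² D² 𝔼‖g‖²`. -/
theorem lintegral_stepIncrement_sq_le (hG : Measurable (Function.uncurry G))
    (hsub : SubGaussianIncrements ν G L₀) (hγ : 0 < γ) (hγ1 : γ ≤ 1) (hx : ‖x - a‖ ≤ D) :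
    ∫⁻ w, ENNReal.ofReal (stepIncrement γ γ G a x w ^ 2)
      ∂((expMeasure 1).prod ((gaussianVec n γ).prod ν))
        ≤ ENNReal.ofReal ((2 * (n ^ 2 * (L₀ ^ 2 + 4 * L₀ ^ 4)) + 16 * D ^ 2 * n * L₀ ^ 2)
            * γ ^ 2) := by
  have hle : ∀ w, ENNReal.ofReal (stepIncrement γ γ G a x w ^ 2)
      ≤ ENNReal.ofReal (2 * γ ^ 4)
          * ENNReal.ofReal (‖esGs γ (fun y => G y w.2.2) x w.1 w.2.1‖ ^ 4)
        + ENNReal.ofReal (8 * γ ^ 2 * D ^ 2)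
          * ENNReal.ofReal (‖esGs γ (fun y => G y w.2.2) x w.1 w.2.1‖ ^ 2) := by
    intro w
    rw [← ENNReal.ofReal_mul (by positivity), ← ENNReal.ofReal_mul (by positivity),
      ← ENNReal.ofReal_add (by positivity) (by positivity)]
    refine ENNReal.ofReal_le_ofReal ?_
    rw [stepIncrement]
    generalize esGs γ (fun y => G y w.2.2) x w.1 w.2.1 = u
    have h1 : (inner ℝ u (x - a)) ^ 2 ≤ ‖u‖ ^ 2 * D ^ 2 := by
      rw [← sq_abs, ← mul_pow]
      gcongr
      exact (abs_real_inner_le_norm u (x - a)).trans (by gcongr)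
    have h2 : γ ^ 2 * (inner ℝ u (x - a)) ^ 2 ≤ γ ^ 2 * (‖u‖ ^ 2 * D ^ 2) := by gcongr
    nlinarith [sq_nonneg (γ ^ 2 * ‖u‖ ^ 2 + 2 * γ * inner ℝ u (x - a))]
  have hm := measurable_esGs_section hG γ x
  refine (lintegral_mono hle).trans ?_
  rw [lintegral_add_left (by fun_prop), lintegral_const_mul _ (by fun_prop),
    lintegral_const_mul _ (by fun_prop)]
  refine (add_le_add (mul_le_mul_right (lintegral_norm_esGs_fourth_le hG hsub hγ hγ1 x) _)
    (mul_le_mul_right (lintegral_norm_esGs_sq_le hG hsub hγ x) _)).trans_eq ?_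
  rw [← ENNReal.ofReal_mul (by positivity), ← ENNReal.ofReal_mul (by positivity),
    ← ENNReal.ofReal_add (by positivity) (by positivity)]
  congr 1
  field_simp
  ring

theorem integral_stepIncrement_le (h : ConvexStochasticModel ν G f)
    (hsub : SubGaussianIncrements ν G L₀) (hL : 0 < L₀) (hγ : 0 ≤ γ) (hη : 0 < η)
    (a x : Vec n) :
    ∫ w, stepIncrement γ η G a x w ∂((expMeasure 1).prod ((gaussianVec n η).prod ν))
      ≤ γ ^ 2 * (n * (2 * L₀ ^ 2)) - 2 * γ * (f x - f a - L₀ * η * ((1 + n) / 2)) := by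
  have hm := measurable_esGs_section h.measurable η x
  have hsq := lintegral_norm_esGs_sq_le h.measurable hsub hη x
  have hi1 := integrable_sq_of_lintegral_le hm.norm hsq
  have hle1 := integral_le_of_lintegral_ofReal_le (hm.norm.pow_const 2) (fun w => sq_nonneg _)
    (by positivity) hsq
  have hic : ∀ i ∈ Finset.univ, Integrable (fun w : ℝ × Vec n × S =>
      esGs η (fun y => G y w.2.2) x w.1 w.2.1 i * (x i - a i))
      ((expMeasure 1).prod ((gaussianVec n η).prod ν)) := fun i _ =>
    (integrable_esGs_coord h.measurable hsub hη x i).mul_const _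
  have hin : ∀ u : Vec n, inner ℝ u (x - a) = ∑ i, u i * (x i - a i) := by
    intro u
    simp [PiLp.inner_apply, mul_comm]
  have hi2 : Integrable (fun w : ℝ × Vec n × S =>
      inner ℝ (esGs η (fun y => G y w.2.2) x w.1 w.2.1) (x - a))
      ((expMeasure 1).prod ((gaussianVec n η).prod ν)) := by
    simp only [hin]
    exact integrable_finsetSum _ hic
  have hmean : ∫ w : ℝ × Vec n × S, inner ℝ (esGs η (fun y => G y w.2.2) x w.1 w.2.1) (x - a)
      ∂((expMeasure 1).prod ((gaussianVec n η).prod ν))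
        = ∑ i, smoothedPartial η f x i * (x i - a i) := by
    simp only [hin]
    rw [integral_finsetSum _ hic]
    refine Finset.sum_congr rfl fun i _ => ?_
    rw [integral_mul_const, integral_esGs_coord h hsub hη x i]
  have hkey := gaussianSmoothing_add_sum_le (h.abs_sub_le hsub hL) h.convex hL.le hη x a
  unfold stepIncrement
  rw [integral_sub (hi1.const_mul _) (hi2.const_mul _), integral_const_mul, integral_const_mul,
    hmean]
  gcongr

end StepIncrement

open Topology

/-! ### A strong law for martingale differences -/

/-- **Kronecker's lemma**. -/
theorem tendsto_sum_div_of_tendsto_sum_div {y b : ℕ → ℝ} {m : ℝ} (hb0 : ∀ k, 0 < b k)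
    (hb : Monotone b) (hb_top : Tendsto b atTop atTop)
    (h : Tendsto (fun K => ∑ k ∈ Finset.range K, y k / b (k + 1)) atTop (𝓝 m)) :
    Tendsto (fun K => (∑ k ∈ Finset.range K, y k) / b K) atTop (𝓝 0) := by
  set M : ℕ → ℝ := fun K => ∑ k ∈ Finset.range K, y k / b (k + 1) with hM
  have hsum : ∀ K, ∑ k ∈ Finset.range K, (b (k + 1) - b k) = b K - b 0 := fun K =>
    Finset.sum_range_sub b K
  -- Summation by parts centred at the limit `m`; the remaining sum is a weighted Cesàro sum of the
  -- null sequence `M k - m`.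
  have habel : ∀ K, ∑ k ∈ Finset.range K, y k
      = b K * (M K - m) + b 0 * m - ∑ k ∈ Finset.range K, (b (k + 1) - b k) * (M k - m) := by
    intro K
    induction K with
    | zero => simp [hM]
    | succ K ih =>
      have hMs : M (K + 1) = M K + y K / b (K + 1) := Finset.sum_range_succ _ _
      have hy : y K = b (K + 1) * (y K / b (K + 1)) := by
        rw [mul_div_cancel₀ _ (hb0 _).ne']
      rw [Finset.sum_range_succ, Finset.sum_range_succ, ih, hMs]
      linear_combination hy
  have hM0 : Tendsto (fun k => M k - m) atTop (𝓝 0) := by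
    simpa using h.sub_const m
  have hbdiff : Tendsto (fun K => ∑ k ∈ Finset.range K, (b (k + 1) - b k)) atTop atTop := by
    simp only [hsum]
    exact tendsto_atTop_add_const_right _ (-b 0) hb_top
  have hlo : (fun k => (b (k + 1) - b k) * (M k - m)) =o[atTop] fun k => b (k + 1) - b k := by
    have h1 := (Asymptotics.isBigO_refl (fun k => b (k + 1) - b k) atTop).mul_isLittleO
      ((Asymptotics.isLittleO_one_iff ℝ).2 hM0)
    simpa using h1
  have hlo' := hlo.sum_range (fun k => sub_nonneg.2 (hb k.le_succ)) hbdiff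
  have hlo2 : (fun K => ∑ k ∈ Finset.range K, (b (k + 1) - b k) * (M k - m)) =o[atTop] b := by
    refine hlo'.trans_isBigO (Asymptotics.IsBigO.of_bound 1 (Eventually.of_forall fun K => ?_))
    rw [hsum, Real.norm_eq_abs, Real.norm_eq_abs, abs_of_pos (hb0 K),
      abs_of_nonneg (sub_nonneg.2 (hb K.zero_le)), one_mul]
    linarith [hb0 0]
  have hdiv : ∀ K, (∑ k ∈ Finset.range K, y k) / b K = (M K - m) + b 0 * m / b K
      - (∑ k ∈ Finset.range K, (b (k + 1) - b k) * (M k - m)) / b K := by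
    intro K
    rw [habel]
    have := (hb0 K).ne'
    field_simp
  simp only [hdiv]
  have h2 : Tendsto (fun K => b 0 * m / b K) atTop (𝓝 0) := hb_top.const_div_atTop _
  simpa using (hM0.add h2).sub hlo2.tendsto_div_nhds_zero

/-- Telescoping, from `d k / b (k + 1)² ≤ 1 / b k - 1 / b (k + 1)`. It bounds the normalised
martingale in `L²`. -/
theorem sum_div_sq_le_one {b d : ℕ → ℝ} (hb0 : b 0 = 1) (hd : ∀ k, 0 ≤ d k)
    (hb : ∀ k, b (k + 1) = b k + d k) (K : ℕ) :
    ∑ k ∈ Finset.range K, d k / b (k + 1) ^ 2 ≤ 1 := by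
  have hpos : ∀ k, 0 < b k := by
    intro k
    induction k with
    | zero => simp [hb0]
    | succ k ih => rw [hb]; linarith [hd k]
  have key : ∑ k ∈ Finset.range K, d k / b (k + 1) ^ 2 ≤ 1 - 1 / b K := by
    induction K with
    | zero => simp [hb0]
    | succ K ih =>
      rw [Finset.sum_range_succ]
      have h1 : d K / b (K + 1) ^ 2 ≤ 1 / b K - 1 / b (K + 1) := by
        rw [div_sub_div _ _ (hpos K).ne' (hpos _).ne', div_le_div_iff₀
          (pow_pos (hpos _) 2) (mul_pos (hpos _) (hpos _))]
        have h2 : b K ≤ b (K + 1) := by rw [hb]; linarith [hd K]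
        have h3 : 1 * b (K + 1) - b K * 1 = d K := by rw [hb]; ring
        rw [h3]
        have := mul_nonneg (hd K) (hpos (K + 1)).le
        nlinarith
      linarith
  have : 0 < 1 / b K := one_div_pos.2 (hpos K)
  linarith

section Martingale

variable {Ω : Type*} {mΩ : MeasurableSpace Ω} {P : Measure Ω} [IsProbabilityMeasure P]
  {ℱ : Filtration ℕ mΩ} {Y : ℕ → Ω → ℝ}

theorem integral_mul_eq_zero_of_condExp_eq_zero {m : MeasurableSpace Ω} (hm : m ≤ mΩ)
    {A B : Ω → ℝ} (hA : StronglyMeasurable[m] A) (hA2 : MemLp A 2 P) (hB2 : MemLp B 2 P)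
    (hB : P[B | m] =ᵐ[P] 0) : ∫ ω, A ω * B ω ∂P = 0 := by
  have hAB : Integrable (A * B) P := hA2.integrable_mul hB2
  have h := condExp_mul_of_stronglyMeasurable_left hA hAB (hB2.integrable one_le_two)
  have h2 : P[A * B | m] =ᵐ[P] 0 := by
    filter_upwards [h, hB] with ω h1 h3
    simp [h1, h3]
  change ∫ ω, (A * B) ω ∂P = 0
  rw [← integral_condExp hm, integral_congr_ae h2]
  simp

/-- Martingale differences with `𝔼[Yₖ²] ≤ c dₖ` satisfy `∑_{k<K} Yₖ = o(1 + ∑_{k<K} dₖ)` almost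
surely. -/
theorem ae_tendsto_sum_div_of_condExp_eq_zero {d b : ℕ → ℝ} {c : ℝ}
    (hY_meas : ∀ k, StronglyMeasurable[ℱ (k + 1)] (Y k)) (hY2 : ∀ k, MemLp (Y k) 2 P)
    (hY0 : ∀ k, P[Y k | ℱ k] =ᵐ[P] 0) (hYc : ∀ k, ∫ ω, Y k ω ^ 2 ∂P ≤ c * d k)
    (hc : 0 ≤ c) (hb0 : b 0 = 1) (hd : ∀ k, 0 ≤ d k) (hb : ∀ k, b (k + 1) = b k + d k)
    (hb_top : Tendsto b atTop atTop) :
    ∀ᵐ ω ∂P, Tendsto (fun K => (∑ k ∈ Finset.range K, Y k ω) / b K) atTop (𝓝 0) := by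
  have hmono : Monotone b := monotone_nat_of_le_succ fun k => by rw [hb]; linarith [hd k]
  have hpos : ∀ k, 0 < b k := fun k => by linarith [hmono k.zero_le]
  -- The sums normalised term by term form an `L²`-bounded martingale; it converges almost surely,
  -- and Kronecker's lemma converts this into the claim.
  set M : ℕ → Ω → ℝ := fun K ω => ∑ k ∈ Finset.range K, Y k ω / b (k + 1) with hM
  have hMs : ∀ K, M (K + 1) = fun ω => M K ω + Y K ω / b (K + 1) := fun K => by
    funext ω
    exact Finset.sum_range_succ _ _
  have hadp : ∀ K, StronglyMeasurable[ℱ K] (M K) := by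
    intro K
    refine Finset.stronglyMeasurable_fun_sum _ fun k hk => ?_
    have hk' := (hY_meas k).mono (ℱ.mono (Finset.mem_range.1 hk))
    exact (hk'.measurable.div_const _).stronglyMeasurable
  have hYd2 : ∀ k, MemLp (fun ω => Y k ω / b (k + 1)) 2 P := fun k => by
    simpa only [div_eq_inv_mul] using (hY2 k).const_mul (b (k + 1))⁻¹
  have hM2 : ∀ K, MemLp (M K) 2 P := fun K => memLp_finsetSum _ fun k _ => hYd2 k
  have hYd0 : ∀ k, P[fun ω => Y k ω / b (k + 1) | ℱ k] =ᵐ[P] 0 := by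
    intro k
    have h1 : (fun ω => Y k ω / b (k + 1)) = (b (k + 1))⁻¹ • Y k := by
      funext ω
      simp [div_eq_inv_mul]
    rw [h1]
    filter_upwards [condExp_smul (b (k + 1))⁻¹ (Y k) (ℱ k) (μ := P), hY0 k] with ω h2 h3
    simp [h2, h3]
  have hmart : Martingale M ℱ P := by
    refine martingale_of_condExp_sub_eq_zero_nat hadp (fun K => (hM2 K).integrable one_le_two)
      fun K => ?_
    have h1 : M (K + 1) - M K = fun ω => Y K ω / b (K + 1) := by
      funext ω
      simp [hMs]
    rw [h1]
    exact hYd0 K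
  have hvar : ∀ K, ∫ ω, M K ω ^ 2 ∂P ≤ c * ∑ k ∈ Finset.range K, d k / b (k + 1) ^ 2 := by
    intro K
    induction K with
    | zero => simp [hM]
    | succ K ih =>
      have h1 : ∀ ω, M (K + 1) ω ^ 2 = M K ω ^ 2
          + (2 * (M K ω * (Y K ω / b (K + 1))) + (Y K ω / b (K + 1)) ^ 2) := fun ω => by
        rw [hMs]
        ring
      have hi1 : Integrable (fun ω => M K ω * (Y K ω / b (K + 1))) P :=
        (hM2 K).integrable_mul (hYd2 K)
      have hi2 := (hYd2 K).integrable_sq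
      have hi3 : Integrable (fun ω => 2 * (M K ω * (Y K ω / b (K + 1)))
          + (Y K ω / b (K + 1)) ^ 2) P := (hi1.const_mul 2).add hi2
      simp only [h1]
      rw [integral_add (hM2 K).integrable_sq hi3,
        integral_add (hi1.const_mul 2) hi2, integral_const_mul,
        integral_mul_eq_zero_of_condExp_eq_zero (ℱ.le K) (hadp K) (hM2 K) (hYd2 K) (hYd0 K),
        Finset.sum_range_succ, mul_add, mul_zero, zero_add]
      refine add_le_add ih ?_
      simp only [div_pow]
      rw [integral_div, ← mul_div_assoc]
      gcongr
      exact hYc K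
  have hbdd : ∀ K, eLpNorm (M K) 1 P ≤ ((1 + c).toNNReal : ENNReal) := by
    intro K
    have hi : Integrable (M K) P := (hM2 K).integrable one_le_two
    rw [eLpNorm_one_eq_lintegral_enorm, ← ofReal_integral_norm_eq_lintegral_enorm hi]
    refine ENNReal.ofReal_le_ofReal ?_
    have hle : ∫ ω, ‖M K ω‖ ∂P ≤ ∫ ω, (1 + M K ω ^ 2) ∂P := by
      refine integral_mono hi.norm ((integrable_const _).add (hM2 K).integrable_sq) fun ω => ?_
      simp only [Real.norm_eq_abs]
      nlinarith [sq_nonneg (|M K ω| - 1), sq_abs (M K ω)]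
    rw [integral_add (integrable_const _) (hM2 K).integrable_sq] at hle
    have h1 := mul_le_mul_of_nonneg_left (sum_div_sq_le_one hb0 hd hb K) hc
    simp only [integral_const, probReal_univ, smul_eq_mul, one_mul] at hle
    linarith [hvar K]
  filter_upwards [hmart.submartingale.ae_tendsto_limitProcess hbdd] with ω hω
  exact tendsto_sum_div_of_tendsto_sum_div hpos hmono hb_top hω

end Martingale

/-! ### Freezing a variable that is known in a conditional expectation -/

section Freezing

variable {Ω E T : Type*} {m mΩ : MeasurableSpace Ω} [MeasurableSpace E] [MeasurableSpace T]
  {P : Measure Ω} [IsProbabilityMeasure P] {μ : Measure T}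
  {X : Ω → E} {W : Ω → T} {U : E → T → ℝ}

theorem map_prodMk_eq_prod_of_indep {E' : Type*} [MeasurableSpace E'] (hm : m ≤ mΩ)
    {X' : Ω → E'} (hX : Measurable[m] X') (hW : Measurable W)
    (hind : Indep (MeasurableSpace.comap W inferInstance) m P) (hlaw : P.map W = μ) :
    P.map (fun ω => (X' ω, W ω)) = (P.map X').prod μ := by
  have hi : IndepFun X' W P := by
    rw [IndepFun_iff_Indep]
    exact indep_of_indep_of_le_left hind.symm hX.comap_le
  rw [hi.map_prod_eq_prod_map_map (hX.mono hm le_rfl).aemeasurable hW.aemeasurable, hlaw]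

variable [IsProbabilityMeasure μ]

theorem condExp_comp_eq_integral (hm : m ≤ mΩ) (hX : Measurable[m] X) (hW : Measurable W)
    (hind : Indep (MeasurableSpace.comap W inferInstance) m P) (hlaw : P.map W = μ)
    (hU : Measurable (Function.uncurry U)) (hi : Integrable (fun ω => U (X ω) (W ω)) P) :
    P[fun ω => U (X ω) (W ω) | m] =ᵐ[P] fun ω => ∫ w, U (X ω) w ∂μ := by
  have hX' : Measurable X := hX.mono hm le_rfl
  have hu : StronglyMeasurable fun x => ∫ w, U x w ∂μ :=
    StronglyMeasurable.integral_prod_right hU.stronglyMeasurable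
  have hlawXW := map_prodMk_eq_prod_of_indep hm hX hW hind hlaw
  have hi' : Integrable (Function.uncurry U) ((P.map X).prod μ) := by
    rw [← hlawXW, integrable_map_measure hU.aestronglyMeasurable (hX'.prodMk hW).aemeasurable]
    exact hi
  have hiu : Integrable (fun ω => ∫ w, U (X ω) w ∂μ) P :=
    (integrable_map_measure hu.aestronglyMeasurable hX'.aemeasurable).1 hi'.integral_prod_left
  refine (ae_eq_condExp_of_forall_setIntegral_eq hm hi (fun s _ _ => hiu.integrableOn)
    (fun A hA _ => ?_) (hu.measurable.comp hX).stronglyMeasurable.aestronglyMeasurable).symm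
  have hA' : MeasurableSet A := hm A hA
  -- The indicator of the test event is adjoined to `X`: the pair is still known, hence independent
  -- of `W`, and Fubini applies to the product with the indicator.
  have hpair : Measurable[m] fun ω => (X ω, A.indicator (fun _ => (1 : ℝ)) ω) :=
    hX.prodMk (measurable_const.indicator hA)
  have hpair' := hpair.mono hm le_rfl
  have hlaw2 := map_prodMk_eq_prod_of_indep hm hpair hW hind hlaw
  have hF : Measurable fun q : (E × ℝ) × T => q.1.2 * U q.1.1 q.2 :=
    (measurable_snd.comp measurable_fst).mul
      (hU.comp ((measurable_fst.comp measurable_fst).prodMk measurable_snd))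
  have hprod : ∫ q, q.1.2 * U q.1.1 q.2
      ∂((P.map fun ω => (X ω, A.indicator (fun _ => (1 : ℝ)) ω)).prod μ)
      = ∫ ω, A.indicator (fun _ => (1 : ℝ)) ω * U (X ω) (W ω) ∂P := by
    rw [← hlaw2, integral_map (hpair'.prodMk hW).aemeasurable hF.aestronglyMeasurable]
  have hind1 : ∀ (φ : Ω → ℝ) (ω : Ω),
      A.indicator (fun _ => (1 : ℝ)) ω * φ ω = A.indicator φ ω := by
    intro φ ω
    by_cases hω : ω ∈ A <;> simp [hω]
  have hiF : Integrable (fun q : (E × ℝ) × T => q.1.2 * U q.1.1 q.2)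
      ((P.map fun ω => (X ω, A.indicator (fun _ => (1 : ℝ)) ω)).prod μ) := by
    rw [← hlaw2, integrable_map_measure hF.aestronglyMeasurable (hpair'.prodMk hW).aemeasurable]
    refine (hi.indicator hA').congr (ae_of_all _ fun ω => ?_)
    exact (hind1 (fun ω => U (X ω) (W ω)) ω).symm
  rw [integral_prod _ hiF] at hprod
  simp only [integral_const_mul] at hprod
  rw [integral_map hpair'.aemeasurable (by
    exact ((measurable_snd.mul (hu.measurable.comp measurable_fst))).aestronglyMeasurable)] at hprod
  simp only [hind1 (fun ω => U (X ω) (W ω)), hind1 (fun ω => ∫ w, U (X ω) w ∂μ)] at hprod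
  rwa [integral_indicator hA', integral_indicator hA'] at hprod

theorem stronglyMeasurable_centered_comp (hU : Measurable (Function.uncurry U))
    (hX : Measurable[m] X) (hW : Measurable[m] W) :
    StronglyMeasurable[m] fun ω => U (X ω) (W ω) - ∫ w, U (X ω) w ∂μ := by
  have hu : StronglyMeasurable fun x => ∫ w, U x w ∂μ :=
    StronglyMeasurable.integral_prod_right hU.stronglyMeasurable
  exact ((hU.comp (hX.prodMk hW)).sub (hu.measurable.comp hX)).stronglyMeasurable

/-- The centred variable `U(X, W) - 𝔼[U(x, W)]|_{x = X}` is a martingale difference in `L²`. -/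
theorem centered_comp_properties {r : ℝ} (hr : 0 < r) (hm : m ≤ mΩ) (hX : Measurable[m] X)
    (hW : Measurable W) (hind : Indep (MeasurableSpace.comap W inferInstance) m P)
    (hlaw : P.map W = μ) (hU : Measurable (Function.uncurry U))
    (hbound : ∀ ω, ∫⁻ w, ENNReal.ofReal (U (X ω) w ^ 2) ∂μ ≤ ENNReal.ofReal (r ^ 2)) :
    MemLp (fun ω => U (X ω) (W ω) - ∫ w, U (X ω) w ∂μ) 2 P ∧
      P[fun ω => U (X ω) (W ω) - ∫ w, U (X ω) w ∂μ | m] =ᵐ[P] 0 ∧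
      ∫ ω, (U (X ω) (W ω) - ∫ w, U (X ω) w ∂μ) ^ 2 ∂P ≤ 4 * r ^ 2 := by
  have hX' : Measurable X := hX.mono hm le_rfl
  have hu : StronglyMeasurable fun x => ∫ w, U x w ∂μ :=
    StronglyMeasurable.integral_prod_right hU.stronglyMeasurable
  have huX : Measurable[m] fun ω => ∫ w, U (X ω) w ∂μ := hu.measurable.comp hX
  have huX' : Measurable fun ω => ∫ w, U (X ω) w ∂μ := huX.mono hm le_rfl
  have hUXW : Measurable fun ω => U (X ω) (W ω) := hU.comp (hX'.prodMk hW)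
  have hlawXW := map_prodMk_eq_prod_of_indep hm hX hW hind hlaw
  have hsec : ∀ x, Measurable (U x) := fun x => hU.comp measurable_prodMk_left
  have hsqm : Measurable fun q : E × T => ENNReal.ofReal (U q.1 q.2 ^ 2) :=
    (hU.pow_const 2).ennreal_ofReal
  have hsq : ∫⁻ ω, ENNReal.ofReal (U (X ω) (W ω) ^ 2) ∂P ≤ ENNReal.ofReal (r ^ 2) := by
    calc ∫⁻ ω, ENNReal.ofReal (U (X ω) (W ω) ^ 2) ∂P
        = ∫⁻ q, ENNReal.ofReal (U q.1 q.2 ^ 2) ∂((P.map X).prod μ) := by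
          rw [← hlawXW, lintegral_map hsqm (hX'.prodMk hW)]
      _ = ∫⁻ ω, ∫⁻ w, ENNReal.ofReal (U (X ω) w ^ 2) ∂μ ∂P := by
          rw [lintegral_prod _ hsqm.aemeasurable, lintegral_map hsqm.lintegral_prod_right' hX']
      _ ≤ ∫⁻ _, ENNReal.ofReal (r ^ 2) ∂P := lintegral_mono hbound
      _ = ENNReal.ofReal (r ^ 2) := by simp
  have hisq := integrable_sq_of_lintegral_le hUXW hsq
  have hi := integrable_of_integrable_sq hUXW hisq
  have hub : ∀ ω, |∫ w, U (X ω) w ∂μ| ≤ r := fun ω =>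
    abs_integral_le_of_integral_sq_le hr (hsec _)
      (integrable_sq_of_lintegral_le (hsec _) (hbound ω))
      (integral_le_of_lintegral_ofReal_le ((hsec _).pow_const 2) (fun w => sq_nonneg _)
        (sq_nonneg r) (hbound ω))
  have hiu : Integrable (fun ω => ∫ w, U (X ω) w ∂μ) P :=
    (integrable_const r).mono' huX'.aestronglyMeasurable (ae_of_all _ hub)
  have hle : ∀ ω, (U (X ω) (W ω) - ∫ w, U (X ω) w ∂μ) ^ 2
      ≤ 2 * U (X ω) (W ω) ^ 2 + 2 * r ^ 2 := by
    intro ω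
    have h1 := sq_le_sq' (abs_le.1 (hub ω)).1 (abs_le.1 (hub ω)).2
    nlinarith [sq_nonneg (U (X ω) (W ω) + ∫ w, U (X ω) w ∂μ)]
  have hib : Integrable (fun ω => 2 * U (X ω) (W ω) ^ 2 + 2 * r ^ 2) P :=
    (hisq.const_mul 2).add (integrable_const _)
  have hiY : Integrable (fun ω => (U (X ω) (W ω) - ∫ w, U (X ω) w ∂μ) ^ 2) P :=
    hib.mono' ((hUXW.sub huX').pow_const 2).aestronglyMeasurable (ae_of_all _ fun ω => by
      rw [Real.norm_eq_abs, abs_of_nonneg (sq_nonneg _)]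
      exact hle ω)
  refine ⟨(memLp_two_iff_integrable_sq (hUXW.sub huX').aestronglyMeasurable).2 hiY, ?_, ?_⟩
  · have h1 := condExp_comp_eq_integral hm hX hW hind hlaw hU hi
    have h2 := condExp_of_stronglyMeasurable hm huX.stronglyMeasurable hiu
    filter_upwards [condExp_sub hi hiu m, h1] with ω h3 h4
    refine h3.trans ?_
    rw [Pi.sub_apply, h4, h2]
    simp
  · refine (integral_mono hiY hib hle).trans ?_
    rw [integral_add (hisq.const_mul 2) (integrable_const _), integral_const_mul]
    have := integral_le_of_lintegral_ofReal_le (hUXW.pow_const 2) (fun ω => sq_nonneg _)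
      (sq_nonneg r) hsq
    simp only [integral_const, probReal_univ, smul_eq_mul, one_mul]
    linarith

end Freezing

/-! ### Euclidean projections -/

section Projection

variable {n : ℕ} {X : Set (Vec n)} {u u' y y' : Vec n}

theorem IsEuclideanProjection.inner_le_zero (hX : Convex ℝ X) (h : IsEuclideanProjection X u y)
    {z : Vec n} (hz : z ∈ X) : inner ℝ (u - y) (z - y) ≤ 0 := by
  have hne : Nonempty X := ⟨⟨y, h.1⟩⟩
  have hinf : ‖u - y‖ = ⨅ w : X, ‖u - w‖ := by
    refine le_antisymm (le_ciInf fun w => h.2 w w.2) ?_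
    exact ciInf_le ⟨0, by rintro _ ⟨w, rfl⟩; exact norm_nonneg _⟩ (⟨y, h.1⟩ : X)
  exact (norm_eq_iInf_iff_real_inner_le_zero hX h.1).1 hinf z hz

theorem IsEuclideanProjection.norm_sub_sq_le (hX : Convex ℝ X) (h : IsEuclideanProjection X u y)
    {z : Vec n} (hz : z ∈ X) : ‖y - z‖ ^ 2 ≤ ‖u - z‖ ^ 2 := by
  have h1 := h.inner_le_zero hX hz
  have h2 : u - z = (u - y) - (z - y) := by abel
  have h3 := norm_sub_sq_real (u - y) (z - y)
  rw [← h2] at h3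
  rw [norm_sub_rev y z]
  nlinarith [sq_nonneg ‖u - y‖]

theorem IsEuclideanProjection.norm_sub_le (hX : Convex ℝ X) (h : IsEuclideanProjection X u y)
    (h' : IsEuclideanProjection X u' y') : ‖y - y'‖ ≤ ‖u - u'‖ := by
  have h1 := h.inner_le_zero hX h'.1
  have h2 := h'.inner_le_zero hX h.1
  have h3 : ‖y - y'‖ ^ 2 ≤ inner ℝ (u - u') (y - y') := by
    have h4 : inner ℝ (u - u') (y - y') - ‖y - y'‖ ^ 2
        = -inner ℝ (u - y) (y' - y) - inner ℝ (u' - y') (y - y') := by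
      rw [← real_inner_self_eq_norm_sq, ← inner_sub_left, ← neg_sub y y', inner_neg_right,
        neg_neg, ← inner_sub_left]
      congr 1
      abel
    linarith
  have h5 := h3.trans (real_inner_le_norm _ _)
  rcases (norm_nonneg (y - y')).eq_or_lt with h0 | h0
  · rw [← h0]
    exact norm_nonneg _
  · nlinarith

/-- A pointwise projection of a measurable map onto a convex set is measurable, even if the set is
not. -/
theorem measurable_of_isEuclideanProjection {Ω : Type*} {m : MeasurableSpace Ω}
    {φ ψ : Ω → Vec n} (hX : Convex ℝ X) (hφ : Measurable φ)
    (h : ∀ ω, IsEuclideanProjection X (φ ω) (ψ ω)) : Measurable ψ := by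
  have hfac : ∀ ω ω', ‖ψ ω - ψ ω'‖ ≤ ‖φ ω - φ ω'‖ := fun ω ω' => (h ω).norm_sub_le hX (h ω')
  have hft : Function.FactorsThrough ψ φ := by
    intro ω ω' hωω'
    have := hfac ω ω'
    rw [hωω', sub_self, norm_zero] at this
    exact sub_eq_zero.1 (norm_le_zero_iff.1 this)
  have hext : ∀ ω, Function.extend φ ψ (fun _ => 0) (φ ω) = ψ ω := fun ω => hft.extend_apply _ ω
  -- Projections are nonexpansive, so `ψ` is a Lipschitz function of `φ` on its range; a Lipschitz
  -- extension to the whole space is continuous, hence measurable.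
  have hlip : LipschitzOnWith 1 (Function.extend φ ψ fun _ => 0) (Set.range φ) := by
    refine LipschitzOnWith.of_dist_le_mul ?_
    rintro _ ⟨ω, rfl⟩ _ ⟨ω', rfl⟩
    rw [hext, hext, dist_eq_norm, dist_eq_norm, NNReal.coe_one, one_mul]
    exact hfac ω ω'
  obtain ⟨g, hg, hgeq⟩ := hlip.extend_finite_dimension
  have : ψ = g ∘ φ := by
    funext ω
    rw [Function.comp_apply, ← hgeq ⟨ω, rfl⟩, hext]
  rw [this]
  exact hg.continuous.measurable.comp hφ

end Projection

/-! ### The algorithm -/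

theorem invSqrtStep_pos (k : ℕ) : 0 < invSqrtStep k := by
  unfold invSqrtStep
  positivity

theorem invSqrtStep_le_one (k : ℕ) : invSqrtStep k ≤ 1 := by
  unfold invSqrtStep
  rw [div_le_one (by positivity), Real.one_le_sqrt]
  linarith [Nat.cast_nonneg (α := ℝ) k]

theorem invSqrtStep_sq (k : ℕ) : invSqrtStep k ^ 2 = 1 / ((k : ℝ) + 1) := by
  rw [invSqrtStep, div_pow, Real.sq_sqrt (by positivity), one_pow]

theorem sqrt_le_sum_invSqrtStep (K : ℕ) : √(K : ℝ) ≤ ∑ k ∈ Finset.range K, invSqrtStep k := by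
  rcases Nat.eq_zero_or_pos K with rfl | hK
  · simp
  have hK' : (0 : ℝ) < √(K : ℝ) := Real.sqrt_pos.2 (by exact_mod_cast hK)
  calc √(K : ℝ) = ∑ k ∈ Finset.range K, 1 / √(K : ℝ) := by
        rw [Finset.sum_const, Finset.card_range, nsmul_eq_mul, mul_one_div, eq_div_iff hK'.ne',
          Real.mul_self_sqrt (Nat.cast_nonneg K)]
    _ ≤ ∑ k ∈ Finset.range K, invSqrtStep k := by
        refine Finset.sum_le_sum fun k hk => ?_
        unfold invSqrtStep
        gcongr
        exact_mod_cast Finset.mem_range.1 hk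

theorem sum_one_div_succ_le (K : ℕ) :
    ∑ k ∈ Finset.range K, (1 : ℝ) / ((k : ℝ) + 1) ≤ 1 + Real.log K := by
  refine le_of_eq_of_le ?_ (harmonic_le_one_add_log K)
  simp [harmonic]

section Algorithm

variable {n : ℕ} {S Ω : Type*} [MeasurableSpace S] [mΩ : MeasurableSpace Ω] {P : Measure Ω}
  {ν : Measure S} {G : Vec n → S → ℝ} {X : Set (Vec n)} {γ η : ℕ → ℝ}
  {V : ℕ → Ω → ℝ} {Z : ℕ → Ω → Vec n} {ξ : ℕ → Ω → S} {x : ℕ → Ω → Vec n}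

/-- The initial point together with the first `k` samples. -/
def sampleHistory (V : ℕ → Ω → ℝ) (Z : ℕ → Ω → Vec n) (ξ : ℕ → Ω → S) (x : ℕ → Ω → Vec n)
    (k : ℕ) (ω : Ω) : Vec n × (Fin k → ℝ × Vec n × S) :=
  (x 0 ω, fun j : Fin k => (V j ω, Z j ω, ξ j ω))

namespace IsZerothOrderSGD

theorem mem (h : IsZerothOrderSGD P ν G X γ η V Z ξ x) (k : ℕ) (ω : Ω) : x k ω ∈ X := by
  cases k with
  | zero => exact h.init_mem ω
  | succ k => exact (h.step k ω).1

theorem measurable_sample (h : IsZerothOrderSGD P ν G X γ η V Z ξ x) (k : ℕ) :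
    Measurable fun ω => (V k ω, Z k ω, ξ k ω) :=
  (h.measurable_V k).prodMk ((h.measurable_Z k).prodMk (h.measurable_ξ k))

theorem measurable_history (h : IsZerothOrderSGD P ν G X γ η V Z ξ x) (k : ℕ) :
    Measurable (sampleHistory V Z ξ x k) :=
  h.measurable_init.prodMk (measurable_pi_lambda _ fun j => h.measurable_sample j)

/-- The filtration generated by the initial point and the samples. -/
def filtration (h : IsZerothOrderSGD P ν G X γ η V Z ξ x) : Filtration ℕ mΩ where
  -- Level `k` contains the samples with index below `k`: the iterate `x k` is known there, and the
  -- `k`-th sample is still fresh.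
  seq k := MeasurableSpace.comap (sampleHistory V Z ξ x k) inferInstance
  mono' := by
    intro k l hkl
    have hπ : Measurable fun q : Vec n × (Fin l → ℝ × Vec n × S) =>
        ((q.1, fun j : Fin k => q.2 (Fin.castLE hkl j)) : Vec n × (Fin k → ℝ × Vec n × S)) :=
      measurable_fst.prodMk (measurable_pi_lambda _ fun j =>
        (measurable_pi_apply _).comp measurable_snd)
    exact Measurable.comap_le (hπ.comp (comap_measurable (sampleHistory V Z ξ x l)))
  le' k := (h.measurable_history k).comap_le

theorem measurable_sample_filtration (h : IsZerothOrderSGD P ν G X γ η V Z ξ x) (k : ℕ) :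
    Measurable[h.filtration (k + 1)] fun ω => (V k ω, Z k ω, ξ k ω) := by
  have hπ : Measurable fun q : Vec n × (Fin (k + 1) → ℝ × Vec n × S) => q.2 (Fin.last k) :=
    (measurable_pi_apply _).comp measurable_snd
  exact hπ.comp (comap_measurable (sampleHistory V Z ξ x (k + 1)))

theorem measurable_iterate (h : IsZerothOrderSGD P ν G X γ η V Z ξ x)
    (hG : Measurable (Function.uncurry G)) (hX : Convex ℝ X) (k : ℕ) :
    Measurable[h.filtration k] (x k) := by
  induction k with
  | zero => exact measurable_fst.comp (comap_measurable (sampleHistory V Z ξ x 0))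
  | succ k ih =>
    have hx : Measurable[h.filtration (k + 1)] (x k) :=
      ih.mono (h.filtration.mono k.le_succ) le_rfl
    have hg : Measurable[h.filtration (k + 1)]
        fun ω => esGs (η k) (fun y => G y (ξ k ω)) (x k ω) (V k ω) (Z k ω) :=
      (measurable_esGs hG (η k)).comp (hx.prodMk (h.measurable_sample_filtration k))
    exact measurable_of_isEuclideanProjection hX (hx.sub (hg.const_smul (γ k))) (h.step k)

theorem indep_filtration (h : IsZerothOrderSGD P ν G X γ η V Z ξ x) (k : ℕ) :
    Indep (MeasurableSpace.comap (fun ω => (V k ω, Z k ω, ξ k ω)) inferInstance)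
      (h.filtration k) P := by
  have := h.indep k
  rw [IndepFun_iff_Indep] at this
  exact this

theorem norm_sub_sq_succ_le (h : IsZerothOrderSGD P ν G X γ η V Z ξ x) (hX : Convex ℝ X)
    {a : Vec n} (ha : a ∈ X) (k : ℕ) (ω : Ω) :
    ‖x (k + 1) ω - a‖ ^ 2
      ≤ ‖x k ω - a‖ ^ 2 + stepIncrement (γ k) (η k) G a (x k ω) (V k ω, Z k ω, ξ k ω) := by
  refine ((h.step k ω).norm_sub_sq_le hX ha).trans_eq ?_
  rw [stepIncrement]
  generalize esGs (η k) (fun y => G y (ξ k ω)) (x k ω) (V k ω) (Z k ω) = g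
  rw [sub_right_comm, norm_sub_sq_real, norm_smul, mul_pow, Real.norm_eq_abs, sq_abs,
    inner_smul_right, real_inner_comm]
  ring

variable [IsProbabilityMeasure P] [IsProbabilityMeasure ν] {f : Vec n → ℝ} {L₀ : ℝ}

/-- The telescoped descent inequality, with the noise collected in a term of lower order than the
logarithm. -/
theorem ae_exists_noise (h : IsZerothOrderSGD P ν G X invSqrtStep invSqrtStep V Z ξ x)
    (hmod : ConvexStochasticModel ν G f) (hsub : SubGaussianIncrements ν G L₀) (hL : 0 < L₀)
    (hX : Convex ℝ X) (hXb : Bornology.IsBounded X) {a : Vec n} (ha : a ∈ X) :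
    ∀ᵐ ω ∂P, ∃ N : ℕ → ℝ,
      Tendsto (fun K => N K / (1 + ∑ k ∈ Finset.range K, (1 : ℝ) / ((k : ℝ) + 1))) atTop (𝓝 0) ∧
      ∀ K, 2 * ∑ k ∈ Finset.range K, invSqrtStep k * (f (x k ω) - f a)
        ≤ Metric.diam X ^ 2 + N K
          + (n * (2 * L₀ ^ 2) + L₀ * (1 + n))
            * ∑ k ∈ Finset.range K, (1 : ℝ) / ((k : ℝ) + 1) := by
  set D := Metric.diam X with hD
  set μ : ℕ → Measure (ℝ × Vec n × S) := fun k =>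
    (expMeasure 1).prod ((gaussianVec n (invSqrtStep k)).prod ν) with hμ
  set U : ℕ → Vec n → ℝ × Vec n × S → ℝ := fun k =>
    stepIncrement (invSqrtStep k) (invSqrtStep k) G a with hU
  set Y : ℕ → Ω → ℝ := fun k ω =>
    U k (x k ω) (V k ω, Z k ω, ξ k ω) - ∫ w, U k (x k ω) w ∂(μ k) with hY
  -- The final `+ 1` keeps `c` positive even for `n = 0`. Its growth in `n` and `D` affects only the
  -- noise, which is of lower order.
  set c : ℝ := 2 * (n ^ 2 * (L₀ ^ 2 + 4 * L₀ ^ 4)) + 16 * D ^ 2 * n * L₀ ^ 2 + 1 with hc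
  have hcpos : 0 < c := by positivity
  have hdist : ∀ k ω, ‖x k ω - a‖ ≤ D := fun k ω => by
    rw [← dist_eq_norm]
    exact Metric.dist_le_diam_of_mem hXb (h.mem k ω) ha
  have hUm : ∀ k, Measurable (Function.uncurry (U k)) := fun k =>
    measurable_stepIncrement hmod.measurable _ _ a
  have hcent := fun k => centered_comp_properties (P := P) (μ := μ k) (m := h.filtration k)
    (X := x k) (W := fun ω => (V k ω, Z k ω, ξ k ω)) (U := U k) (r := √c * invSqrtStep k)
    (mul_pos (Real.sqrt_pos.2 hcpos) (invSqrtStep_pos k)) (h.filtration.le k)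
    (h.measurable_iterate hmod.measurable hX k) (h.measurable_sample k) (h.indep_filtration k)
    (h.law k) (hUm k) (fun ω => by
      refine (lintegral_stepIncrement_sq_le hmod.measurable hsub (invSqrtStep_pos k)
        (invSqrtStep_le_one k) (hdist k ω)).trans (ENNReal.ofReal_le_ofReal ?_)
      rw [mul_pow, Real.sq_sqrt hcpos.le]
      gcongr
      linarith)
  have hYm : ∀ k, StronglyMeasurable[h.filtration (k + 1)] (Y k) := by
    intro k
    have hx : Measurable[h.filtration (k + 1)] (x k) :=
      (h.measurable_iterate hmod.measurable hX k).mono (h.filtration.mono k.le_succ) le_rfl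
    exact stronglyMeasurable_centered_comp (hUm k) hx (h.measurable_sample_filtration k)
  -- The increments `d k = 1/(k+1)` are the squared step lengths.
  have hconv := ae_tendsto_sum_div_of_condExp_eq_zero (P := P) (ℱ := h.filtration) (Y := Y)
    (d := fun k => (1 : ℝ) / ((k : ℝ) + 1))
    (b := fun K => 1 + ∑ k ∈ Finset.range K, (1 : ℝ) / ((k : ℝ) + 1)) (c := 4 * c)
    hYm (fun k => (hcent k).1) (fun k => (hcent k).2.1)
    (fun k => (hcent k).2.2.trans_eq (by
      rw [mul_pow, Real.sq_sqrt hcpos.le, invSqrtStep_sq]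
      ring))
    (by positivity) (by simp) (fun k => by positivity)
    (fun k => by rw [Finset.sum_range_succ]; ring)
    (tendsto_atTop_add_const_left _ _ Real.tendsto_sum_range_one_div_nat_succ_atTop)
  filter_upwards [hconv] with ω hω
  refine ⟨fun K => ∑ k ∈ Finset.range K, Y k ω, hω, fun K => ?_⟩
  have hstep : ∀ K, ‖x K ω - a‖ ^ 2 + 2 * ∑ k ∈ Finset.range K, invSqrtStep k * (f (x k ω) - f a)
      ≤ D ^ 2 + ∑ k ∈ Finset.range K, Y k ω + (n * (2 * L₀ ^ 2) + L₀ * (1 + n))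
        * ∑ k ∈ Finset.range K, (1 : ℝ) / ((k : ℝ) + 1) := by
    intro K
    induction K with
    | zero =>
      simp only [Finset.range_zero, Finset.sum_empty, mul_zero, add_zero]
      have := hdist 0 ω
      gcongr
    | succ K ih =>
      have h1 := h.norm_sub_sq_succ_le hX ha K ω
      have h2 := integral_stepIncrement_le hmod hsub hL (invSqrtStep_pos K).le
        (invSqrtStep_pos K) a (x K ω)
      have h3 : U K (x K ω) (V K ω, Z K ω, ξ K ω) = Y K ω + ∫ w, U K (x K ω) w ∂(μ K) := by
        rw [hY]
        ring
      simp only [hU, hμ] at h3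
      rw [Finset.sum_range_succ, Finset.sum_range_succ, Finset.sum_range_succ,
        ← invSqrtStep_sq K]
      nlinarith
  have := hstep K
  linarith [sq_nonneg ‖x K ω - a‖]

end IsZerothOrderSGD

end Algorithm

/-! ### Weighted averages and the final rate -/

/-- Jensen's inequality for the weighted average of the iterates. -/
theorem ConvexOn.map_weightedAverage_sub_le {n : ℕ} {f : Vec n → ℝ}
    (hf : ConvexOn ℝ Set.univ f) {γ : ℕ → ℝ} (hγ : ∀ k, 0 ≤ γ k) (x : ℕ → Vec n) (c : ℝ) {K : ℕ}
    (hK : 0 < ∑ k ∈ Finset.range K, γ k) :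
    f (weightedAverage γ x K) - c
      ≤ (∑ k ∈ Finset.range K, γ k * (f (x k) - c)) / ∑ k ∈ Finset.range K, γ k := by
  have h := hf.map_centerMass_le (t := Finset.range K) (w := γ) (p := x) (fun k _ => hγ k) hK
    (fun _ _ => Set.mem_univ _)
  have hc : ∑ k ∈ Finset.range K, γ k * (f (x k) - c)
      = ∑ k ∈ Finset.range K, γ k * f (x k) - (∑ k ∈ Finset.range K, γ k) * c := by
    rw [Finset.sum_mul, ← Finset.sum_sub_distrib]
    exact Finset.sum_congr rfl fun k _ => by ring
  rw [hc, sub_div, mul_div_cancel_left₀ _ hK.ne', div_eq_inv_mul]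
  simp only [Finset.centerMass, smul_eq_mul, Function.comp_apply] at h
  exact sub_le_sub_right h c

theorem weightedAverage_mem {n : ℕ} {X : Set (Vec n)} (hX : Convex ℝ X) {γ : ℕ → ℝ}
    (hγ : ∀ k, 0 ≤ γ k) {x : ℕ → Vec n} (hx : ∀ k, x k ∈ X) {K : ℕ}
    (hK : 0 < ∑ k ∈ Finset.range K, γ k) : weightedAverage γ x K ∈ X :=
  hX.centerMass_mem (fun k _ => hγ k) hK fun k _ => hx k

theorem corollary4p8 (L₀ D : ℝ) (hL₀ : 0 < L₀) :
    ∃ C : ℝ, 0 < C ∧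
      ∀ (n : ℕ) {Ω : Type*} [MeasurableSpace Ω] (P : Measure Ω) [IsProbabilityMeasure P]
        {S : Type*} [MeasurableSpace S] (ν : Measure S) [IsProbabilityMeasure ν]
        (G : Vec n → S → ℝ) (f : Vec n → ℝ) (X : Set (Vec n)) (xstar : Vec n)
        (V : ℕ → Ω → ℝ) (Z : ℕ → Ω → Vec n) (ξ : ℕ → Ω → S) (x : ℕ → Ω → Vec n),
        IsProblemModel ν G f →
        SubGaussianIncrements ν G L₀ →
        Convex ℝ X →
        Bornology.IsBounded X →
        Metric.diam X = D →
        xstar ∈ X →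
        IsMinOn f X xstar →
        IsZerothOrderSGD P ν G X invSqrtStep invSqrtStep V Z ξ x →
        ∀ᵐ ω ∂P, ∀ᶠ K : ℕ in atTop,
          |f (weightedAverage invSqrtStep (fun k => x k ω) K) - f xstar|
            ≤ C * (n * Real.log K / √K) := by
  -- The part `2L₀² + 2L₀` bounds the drift coefficient divided by `n`. The final `2` pays for the
  -- squared diameter and the noise: each is eventually at most `1 + H ≤ 2 log K`, and the descent
  -- inequality carries a factor `2` on its left.
  refine ⟨2 * L₀ ^ 2 + 2 * L₀ + 2, by positivity, ?_⟩
  intro n Ω _ P _ S _ ν _ G f X xstar V Z ξ x hmodel hsub hX hXb _ hstar hmin halg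
  have hmod := hmodel.convexStochasticModel
  filter_upwards [halg.ae_exists_noise hmod hsub hL₀ hX hXb hstar] with ω hω
  obtain ⟨N, hN, hdesc⟩ := hω
  have hb_top := tendsto_atTop_add_const_left atTop (1 : ℝ)
    Real.tendsto_sum_range_one_div_nat_succ_atTop
  have hlog : Tendsto (fun K : ℕ => Real.log K) atTop atTop :=
    Real.tendsto_log_atTop.comp tendsto_natCast_atTop_atTop
  filter_upwards [eventually_gt_atTop 0, hN.eventually (ge_mem_nhds zero_lt_one),
    hb_top.eventually_ge_atTop (Metric.diam X ^ 2), hlog.eventually_ge_atTop 2]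
    with K hK hNK hDK hlogK
  -- In dimension `0` both sides are zero; otherwise `n ≥ 1` absorbs the terms free of `n`.
  rcases Nat.eq_zero_or_pos n with rfl | hn
  · rw [Subsingleton.elim (weightedAverage invSqrtStep (fun k => x k ω) K) xstar]
    simp
  have hn1 : (1 : ℝ) ≤ n := by exact_mod_cast hn
  have hsqrt : 0 < √(K : ℝ) := Real.sqrt_pos.2 (by exact_mod_cast hK)
  have hsum := sqrt_le_sum_invSqrtStep K
  have hsum0 : 0 < ∑ k ∈ Finset.range K, invSqrtStep k := hsqrt.trans_le hsum
  have hγ : ∀ k, 0 ≤ invSqrtStep k := fun k => (invSqrtStep_pos k).le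
  have hlower := hmin (weightedAverage_mem hX hγ (fun k => halg.mem k ω) hsum0)
  rw [abs_of_nonneg (sub_nonneg.2 hlower)]
  have hH := sum_one_div_succ_le K
  have hH0 : 0 ≤ ∑ k ∈ Finset.range K, (1 : ℝ) / ((k : ℝ) + 1) :=
    Finset.sum_nonneg fun k _ => by positivity
  have hd := hdesc K
  rw [div_le_one (by positivity)] at hNK
  generalize (∑ k ∈ Finset.range K, (1 : ℝ) / ((k : ℝ) + 1)) = H at hNK hDK hd hH hH0
  have hmain : ∑ k ∈ Finset.range K, invSqrtStep k * (f (x k ω) - f xstar)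
      ≤ (2 * L₀ ^ 2 + 2 * L₀ + 2) * (n * Real.log K) := by
    have hH2 : 1 + H ≤ 2 * Real.log K := by linarith
    have hcoef : n * (2 * L₀ ^ 2) + L₀ * (1 + n) ≤ n * (2 * L₀ ^ 2 + 2 * L₀) := by nlinarith
    have h1 : (n * (2 * L₀ ^ 2) + L₀ * (1 + n)) * H
        ≤ n * (2 * L₀ ^ 2 + 2 * L₀) * (2 * Real.log K) := by
      gcongr
      linarith
    have h2 : 1 * Real.log K ≤ n * Real.log K := by gcongr
    nlinarith
  calc f (weightedAverage invSqrtStep (fun k => x k ω) K) - f xstar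
      ≤ (∑ k ∈ Finset.range K, invSqrtStep k * (f (x k ω) - f xstar))
          / ∑ k ∈ Finset.range K, invSqrtStep k :=
        hmod.convex.map_weightedAverage_sub_le hγ _ _ hsum0
    _ ≤ (2 * L₀ ^ 2 + 2 * L₀ + 2) * (n * Real.log K) / √K := by
        gcongr
    _ = (2 * L₀ ^ 2 + 2 * L₀ + 2) * (n * Real.log K / √K) := by ring
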